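/- \textbf{Setting.} Let $\mathcal X$ be a finite-dimensional real normed space with norm $\|\cdot\|$, dual space $\mathcal X^*$ with dual norm $\|\cdot\|_*$, and pairing $\langle\cdot,\cdot\rangle$. Let $K\subset\mathcal X$ be nonempty, closed and convex, let $g:K\to(-\infty,+\infty]$ be proper, convex and lower semicontinuous with $\operatorname{dom} g=\{x\in K: g(x)<+\infty\}$, and let $F=\frac1M\sum_{i=1}^M F_i$ be an operator from $\operatorname{dom} g$ to $\mathcal X^*$. The solution set of the variational inequality is $$S_1=\{x^*\in \operatorname{dom} g:\ \langle F(x^*),y-x^*\rangle+g(y)-g(x^*)\ge 0\ \ \forall y\in K\}.$$ Let $f:K\to(-\infty,+\infty]$ be proper, convex and lower semicontinuous with $\operatorname{dom} g\subset\operatorname{dom} f$. Here $\partial f$ is the subdifferential of $f$ (extended by $+\infty$ outside $K$) and $\operatorname{dom}(\partial f)=\{x\in\operatorname{dom} f:\partial f(x)\neq\emptyset\}$. Suppose $f$ is differentiable (relative to $\operatorname{dom} f$) on $\operatorname{dom}(\partial f)$ with gradient $\nabla f$, and 1-strongly convex: $f(x)\ge f(y)+\langle\nabla f(y),x-y\rangle+\frac12\|x-y\|^2$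 for $x\in\operatorname{dom} f$, $y\in\operatorname{dom}(\partial f)$. Put $D(x,y)=f(x)-f(y)-\langle\nabla f(y),x-y\rangle$. \textbf{Assumptions.} (A1) $S_1\ne\emptyset$. (A2) $\langle F(x)-F(y),x-y\rangle\ge0$ for all $x,y\in\operatorname{dom} g$. (A3) There is $\bar L$ such that for all $x,y\in \operatorname{dom} g$ there are a probability distribution $Q_{x,y}$ on $\{1,\dots,M\}$ and maps $F_\xi=F_\xi^{x,y}:\operatorname{dom} g\to\mathcal X^*$, $\xi\in\{1,\dots,M\}$ (possibly depending on $x,y$), with $\mathbb E_{\xi\sim Q_{x,y}}[F_\xi(z)]=F(z)$ for all $z\in\operatorname{dom} g$ and $\mathbb E_{\xi\sim Q_{x,y}}\big[\|F_\xi(x)-F_\xi(y)\|_*^2\big]\le\bar L^2\|x-y\|^2$. (A4) $\|F(x)-F(y)\|_*\le L\|x-y\|$ for all $x,y\in\operatorname{dom} g$, with $L>0$. Moreover every $F_\xi$ is continuous on $\operatorname{dom} g$, and $\nabla f$ is defined (that is, $\operatorname{dom} g\subset\operatorname{dom}(\partial f)$) and continuous on $\operatorname{dom} g$. \textbf{Algorithm.}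 Parameters: $0<\gamma\le1$, $0<p\le1$, $\alpha>0$, $b\in\{1,\dots,M\}$. Take $x_0=x_{-1}=w_0=w_{-1}\in\operatorname{dom} g$. For $s=0,1,2,\dots$: given the past, draw $\xi_1^s,\dots,\xi_b^s$ independently from $Q_{x_s,w_{s-1}}$, let $\bar x_s\in\operatorname{dom}(\partial f)$ satisfy $\nabla f(\bar x_s)=\gamma\nabla f(x_s)+(1-\gamma)\nabla f(x_{s-1})$, and set $$\Delta^s=\frac1b\sum_{j=1}^b\big(F(w_s)+F_{\xi_j^s}(x_s)-F_{\xi_j^s}(w_{s-1})\big),\qquad x_{s+1}=\operatorname*{arg\,min}_{x\in K}\{\alpha g(x)+\langle\alpha\Delta^s,x\rangle+D(x,\bar x_s)\},$$ where $F_{\xi}=F_\xi^{x_s,w_{s-1}}$; then, independently of the past and of the $\xi_j^s$, set $w_{s+1}=x_{s+1}$ with probability $p$ and $w_{s+1}=x_s$ with probability $1-p$. \textbf{Theorem.} If $p=1$ (so that $w_s=x_s$ almost surely), $\alpha<\dfrac{\gamma}{1+\bar L^2}$ and $\alpha\le\dfrac{\sqrt{1+8\gamma L^2}-1}{4L^2}$,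 then almost surely the sequence $(x_s)$ generated by the algorithm converges to a (random) point $\tilde x\in S_1$. -/

import Mathlib

open MeasureTheory Filter Topology

namespace BregmanVI

noncomputable section

variable {E : Type*} [NormedAddCommGroup E] [NormedSpace ℝ E]

/-- The effective domain `{x ∈ K | h x < +∞}` of an extended-real-valued function on `K`.
Functions `h : K → (-∞, +∞]` are given by maps `E → EReal` of which only the values on `K`
are ever used (outside `K` the function counts as `+∞`). -/
def effDom (K : Set E) (h : E → EReal) : Set E := {x | x ∈ K ∧ h x < ⊤}

/-- `h : K → (-∞, +∞]` is proper, convex (convex epigraph) and lower semicontinuous. -/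
structure ProperConvexLSC (K : Set E) (h : E → EReal) : Prop where
  ne_bot : ∀ x ∈ K, h x ≠ ⊥
  nonempty_dom : (effDom K h).Nonempty
  convex_epigraph : Convex ℝ {q : E × ℝ | q.1 ∈ K ∧ h q.1 ≤ (q.2 : EReal)}
  lsc : LowerSemicontinuousOn h K

/-- The subdifferential `∂h(x)` of `h : K → (-∞, +∞]`; points outside `K`, where `h` counts as
`+∞`, impose no condition. -/
def subdiff (K : Set E) (h : E → EReal) (x : E) : Set (StrongDual ℝ E) :=
  {v | ∀ y ∈ K, h x + ((v (y - x) : ℝ) : EReal) ≤ h y}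

/-- `dom (∂h) = {x ∈ dom h | ∂h(x) ≠ ∅}`. -/
def domSubdiff (K : Set E) (h : E → EReal) : Set E :=
  {x | x ∈ effDom K h ∧ (subdiff K h x).Nonempty}

/-- `f : K → (-∞, +∞]` is a distance generating function with gradient `gradf`: it is proper,
convex and lower semicontinuous, `dom g ⊆ dom f`, it is differentiable on `dom (∂f)` with
derivative `gradf`, and it is 1-strongly convex. As `f` lives on `K` only, the derivative is the
Fréchet derivative relative to `dom f`; it is the usual one at interior points of `dom f`. -/
structure IsDistanceGenerating (K : Set E) (g f : E → EReal) (gradf : E → StrongDual ℝ E) :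
    Prop where
  proper : ProperConvexLSC K f
  dom_subset : effDom K g ⊆ effDom K f
  hasGrad : ∀ y ∈ domSubdiff K f,
    HasFDerivWithinAt (fun z => (f z).toReal) (gradf y) (effDom K f) y
  strongConvex : ∀ x ∈ effDom K f, ∀ y ∈ domSubdiff K f,
    (f y).toReal + gradf y (x - y) + 1 / 2 * ‖x - y‖ ^ 2 ≤ (f x).toReal

/-- The Bregman distance `D(x, y) = f(x) - f(y) - ⟨∇f(y), x - y⟩`, for `x ∈ dom f` and
`y ∈ dom (∂f)`. -/
def bregman (f : E → EReal) (gradf : E → StrongDual ℝ E) (x y : E) : ℝ :=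
  (f x).toReal - (f y).toReal - gradf y (x - y)

/-- The objective `α g(z) + ⟨α Δ, z⟩ + D(z, y)` of the generalized Bregman proximal mapping.
At `z ∈ K` outside `dom g` it is `+∞`. -/
def proxObjective (g f : E → EReal) (gradf : E → StrongDual ℝ E) (α : ℝ)
    (Δ : StrongDual ℝ E) (y z : E) : EReal :=
  (α : EReal) * g z + ((α * Δ z + bregman f gradf z y : ℝ) : EReal)

/-- `z` is a minimizer over `K` of the objective of the Bregman proximal mapping, that is,
`z = P_y(Δ, α)`. -/
def IsBregmanProx (K : Set E) (g f : E → EReal) (gradf : E → StrongDual ℝ E) (α : ℝ)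
    (Δ : StrongDual ℝ E) (y z : E) : Prop :=
  z ∈ K ∧ ∀ u ∈ K, proxObjective g f gradf α Δ y z ≤ proxObjective g f gradf α Δ y u

/-- The operator `F = (1/M) ∑ᵢ Fᵢ`. -/
def finiteSum {M : ℕ} (Fi : Fin M → E → StrongDual ℝ E) (x : E) : StrongDual ℝ E :=
  (M : ℝ)⁻¹ • ∑ i, Fi i x

/-- The solution set of the variational inequality: points `x ∈ K ∩ dom g` with
`⟨F(x), y - x⟩ + g(y) - g(x) ≥ 0` for all `y ∈ K`. -/
def solutionSet (K : Set E) (g : E → EReal) (F : E → StrongDual ℝ E) : Set E :=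
  {x | x ∈ effDom K g ∧ ∀ y ∈ K, 0 ≤ ((F x (y - x) : ℝ) : EReal) + g y - g x}

/-- `F` is monotone on `C`. -/
def MonotoneOperatorOn (C : Set E) (F : E → StrongDual ℝ E) : Prop :=
  ∀ x ∈ C, ∀ y ∈ C, 0 ≤ (F x - F y) (x - y)

/-- `F` is `L`-Lipschitz on `C`, the values being measured in the dual norm. -/
def LipschitzOperatorOn (C : Set E) (F : E → StrongDual ℝ E) (L : ℝ) : Prop :=
  ∀ x ∈ C, ∀ y ∈ C, ‖F x - F y‖ ≤ L * ‖x - y‖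

/-- On the domain `C`, `F` has a stochastic oracle that is variable `Lbar`-Lipschitz in mean:
for all `x, y ∈ C` the index `ξ ∈ {1, …, M}` has a distribution `Q x y`, under which the oracle
`G x y ξ` (which may depend on `x, y` together with `Q x y`; the `F_ξ` of the algorithm) is an
unbiased estimator of `F` on `C` and satisfies the mean-square Lipschitz bound at the pair
`x, y`. -/
structure IsVariableLipschitzOracle {M : ℕ} (C : Set E) (F : E → StrongDual ℝ E)
    (Q : E → E → PMF (Fin M)) (G : E → E → Fin M → E → StrongDual ℝ E) (Lbar : ℝ) : Prop where
  unbiased : ∀ x ∈ C, ∀ y ∈ C, ∀ z ∈ C, F z = ∑ i, (Q x y i).toReal • G x y i z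
  lipschitz : ∀ x ∈ C, ∀ y ∈ C,
    ∑ i, (Q x y i).toReal * ‖G x y i x - G x y i y‖ ^ 2 ≤ Lbar ^ 2 * ‖x - y‖ ^ 2

/-- The shifted sequence `s ↦ u_{s-1}`, with the convention `u_{-1} = u_0`. -/
def prev {β : Type*} (u : ℕ → β) : ℕ → β
  | 0 => u 0
  | s + 1 => u s

/-- The batch estimator
`Δ^s = (1/b) ∑_{ξ ∈ B^s} (F(w_s) + F_ξ(x_s) - F_ξ(w_{s-1}))`, as a function of
`x = x_s`, `w = w_s`, `w' = w_{s-1}` and of the sampled indices `ξ 1, …, ξ b`. -/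
def batchEstimator {M b : ℕ} (F : E → StrongDual ℝ E)
    (G : E → E → Fin M → E → StrongDual ℝ E) (x w w' : E) (ξ : Fin b → Fin M) :
    StrongDual ℝ E :=
  (b : ℝ)⁻¹ • ∑ j, (F w + G x w' (ξ j) x - G x w' (ξ j) w')

/-- `x`, `w` are the iterates of the single-loop variance-reduced Bregman method with parameters
`γ, p, α`, batch size `b` and starting point `x₀`, driven by the sampled indices
`ξ s 1, …, ξ s b` and by coins `coin s`, on a probability space with filtration `ℱ` (the history
up to step `s`). The sequence `xbar` consists of the points
`∇f⁻¹(γ ∇f(x_s) + (1 - γ) ∇f(x_{s-1}))`. -/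
structure IsAlgorithmRun {Ω : Type*} {mΩ : MeasurableSpace Ω} (μ : Measure Ω)
    (ℱ : Filtration ℕ mΩ) {M b : ℕ} (K : Set E) (g f : E → EReal)
    (gradf : E → StrongDual ℝ E) (F : E → StrongDual ℝ E) (Q : E → E → PMF (Fin M))
    (G : E → E → Fin M → E → StrongDual ℝ E) (γ p α : ℝ) (x₀ : E)
    (ξ : ℕ → Fin b → Ω → Fin M) (coin : ℕ → Ω → Bool) (x w xbar : ℕ → Ω → E) : Prop where
  x_zero : ∀ ω, x 0 ω = x₀
  w_zero : ∀ ω, w 0 ω = x₀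
  measurable_index : ∀ s j, Measurable (ξ s j)
  measurable_coin : ∀ s, Measurable (coin s)
  adapted_x : StronglyAdapted ℱ x
  adapted_w : StronglyAdapted ℱ w
  /-- Given the history, the indices `ξ s 1, …, ξ s b` are drawn independently from the
  distribution `Q_{x_s, w_{s-1}}`, and the coin is an independent Bernoulli variable with success
  probability `p`. -/
  sampling : ∀ (s : ℕ) (i : Fin b → Fin M) (c : Bool),
    μ[Set.indicator {ω | (∀ j, ξ s j ω = i j) ∧ coin s ω = c} (fun _ => (1 : ℝ)) | ℱ s]
      =ᵐ[μ] fun ω => (∏ j, (Q (x s ω) (prev w s ω) (i j)).toReal) * (if c then p else 1 - p)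
  /-- `xbar_s = ∇f⁻¹(γ ∇f(x_s) + (1 - γ) ∇f(x_{s-1}))`. -/
  xbar_mem : ∀ s ω, xbar s ω ∈ domSubdiff K f
  xbar_eq : ∀ s ω, gradf (xbar s ω) = γ • gradf (x s ω) + (1 - γ) • gradf (prev x s ω)
  /-- `x_{s+1}` is the Bregman proximal point `P_{xbar_s}(Δ^s, α)`. -/
  x_succ : ∀ s ω, IsBregmanProx K g f gradf α
    (batchEstimator F G (x s ω) (w s ω) (prev w s ω) (fun j => ξ s j ω)) (xbar s ω) (x (s + 1) ω)
  /-- `w_{s+1}` is `x_{s+1}` with probability `p` and `x_s` with probability `1 - p`. -/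
  w_succ : ∀ s ω, w (s + 1) ω = if coin s ω then x (s + 1) ω else x s ω

end

end BregmanVI

/-! Since `p = 1`, almost surely `w_s = x_s`. Put `A_s = Δ^s - F(x_s)`. For a solution `u`,
`lyapunov_step` combines the proximal inequality tested at `u`, monotonicity and Young's inequality.
Given the history, `A_s` has mean `F(x_s) - F(x_{s-1})`, and `‖A_s‖²` has mean at most `Lbar² ‖x_s -
x_{s-1}‖²`. The Lyapunov function therefore drops in conditional mean by at least `(γ - α (1 +
Lbar²)) / 2 * ‖x_s - x_{s-1}‖²`; the first step-size condition makes this coefficient positive. The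
second one makes the function dominate `‖x_s - u‖² / 4` (`sq_le_lyapunov`). It is thus a nonnegative
supermartingale and converges almost surely, while the expected squared increments are summable, so
that `x_s - x_{s-1}` and `A_s` tend to `0` almost surely.

The rest is a pathwise argument of Opial type (`tendsto_solution`): a cluster point of the bounded
iterates solves the inequality, and its convergent Bregman distances to the iterates vanish along a
subsequence, hence in the limit.

The null set of the supermartingale theorem depends on `u`, and there may be uncountably many
solutions. But `D(u, y) - f(u)` is affine in `u`, so a finite affine basis of the span of the
solution set suffices.

No measurability of `F`, `Q`, `G` or `gradf` is needed: each iterate takes finitely many values. -/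

namespace BregmanVI

/-! ### The proximal inequality and the one-step Lyapunov estimate. -/

section Deterministic

variable {E : Type*} [NormedAddCommGroup E] [NormedSpace ℝ E]
  {K : Set E} {g f : E → EReal} {gradf : E → StrongDual ℝ E} {F : E → StrongDual ℝ E}

theorem ProperConvexLSC.coe_toReal (hg : ProperConvexLSC K g) {x : E} (hx : x ∈ effDom K g) :
    ((g x).toReal : EReal) = g x :=
  EReal.coe_toReal hx.2.ne (hg.ne_bot x hx.1)

theorem ProperConvexLSC.segment (hg : ProperConvexLSC K g) {x y : E} (hx : x ∈ effDom K g)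
    (hy : y ∈ effDom K g) {t : ℝ} (ht0 : 0 ≤ t) (ht1 : t ≤ 1) :
    x + t • (y - x) ∈ effDom K g ∧
      (g (x + t • (y - x))).toReal ≤ (g x).toReal + t * ((g y).toReal - (g x).toReal) := by
  have hmem := hg.convex_epigraph (x := (x, (g x).toReal)) (y := (y, (g y).toReal))
    ⟨hx.1, (hg.coe_toReal hx).ge⟩ ⟨hy.1, (hg.coe_toReal hy).ge⟩
    (sub_nonneg.2 ht1) ht0 (sub_add_cancel 1 t)
  simp only [Prod.smul_mk, Prod.mk_add_mk, Set.mem_ofPred_eq, smul_eq_mul] at hmem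
  have e1 : (1 - t) • x + t • y = x + t • (y - x) := by module
  have e2 : (1 - t) * (g x).toReal + t * (g y).toReal
      = (g x).toReal + t * ((g y).toReal - (g x).toReal) := by ring
  rw [e1, e2] at hmem
  have hdom : x + t • (y - x) ∈ effDom K g := ⟨hmem.1, hmem.2.trans_lt (EReal.coe_lt_top _)⟩
  refine ⟨hdom, ?_⟩
  rw [← hg.coe_toReal hdom] at hmem
  exact_mod_cast hmem.2

/-- Serves twice at a cluster point of the iterates: to place it in `dom g`, and to pass to the
limit in the proximal inequality. -/
theorem ProperConvexLSC.le_of_tendsto (hg : ProperConvexLSC K g) {ι : Type*} {l : Filter ι}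
    [l.NeBot] {y : ι → E} {z : E} {r : ι → ℝ} {c : ℝ} (hy : ∀ i, y i ∈ K) (hz : z ∈ K)
    (hyz : Tendsto y l (𝓝 z)) (hr : Tendsto r l (𝓝 c)) (hle : ∀ i, g (y i) ≤ r i) :
    g z ≤ c := by
  by_contra! hlt
  obtain ⟨d, hcd, hdz⟩ := EReal.lt_iff_exists_real_btwn.1 hlt
  have h1 := (tendsto_nhdsWithin_iff.2 ⟨hyz, Eventually.of_forall hy⟩).eventually
    (hg.lsc z hz d hdz)
  have h2 := hr.eventually_lt_const (EReal.coe_lt_coe_iff.1 hcd)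
  obtain ⟨i, hi1, hi2⟩ := (h1.and h2).exists
  exact absurd (hi1.trans_le (hle i)) (not_lt.2 (EReal.coe_le_coe_iff.2 hi2.le))

theorem bregman_three_point (a b u : E) :
    (gradf b - gradf a) (u - b)
      = bregman f gradf u a - bregman f gradf u b - bregman f gradf b a := by
  simp only [bregman, sub_apply, map_sub]
  ring

theorem bregman_symm_add (x y : E) :
    bregman f gradf x y + bregman f gradf y x = (gradf x - gradf y) (x - y) := by
  simp only [bregman, sub_apply, map_sub]
  ring

theorem IsDistanceGenerating.sq_le_bregman (hf : IsDistanceGenerating K g f gradf)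
    {x y : E} (hx : x ∈ effDom K g) (hy : y ∈ domSubdiff K f) :
    1 / 2 * ‖x - y‖ ^ 2 ≤ bregman f gradf x y := by
  have := hf.strongConvex x (hf.dom_subset hx) y hy
  unfold bregman
  linarith

theorem IsDistanceGenerating.bregman_nonneg (hf : IsDistanceGenerating K g f gradf)
    {x y : E} (hx : x ∈ effDom K g) (hy : y ∈ domSubdiff K f) :
    0 ≤ bregman f gradf x y :=
  le_trans (by positivity) (hf.sq_le_bregman hx hy)

theorem IsBregmanProx.mem_effDom {α : ℝ} (hα : 0 < α) {Δ : StrongDual ℝ E} {y z u : E}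
    (hg : ProperConvexLSC K g) (hz : IsBregmanProx K g f gradf α Δ y z)
    (hu : u ∈ effDom K g) : z ∈ effDom K g := by
  refine ⟨hz.1, lt_top_iff_ne_top.2 fun htop => ?_⟩
  have h := hz.2 u hu.1
  rw [proxObjective, proxObjective, htop, EReal.coe_mul_top_of_pos hα, EReal.top_add_coe,
    ← hg.coe_toReal hu] at h
  exact absurd h (not_le.2 (by exact_mod_cast EReal.coe_lt_top _))

/-- First-order optimality of the Bregman proximal point. -/
theorem IsBregmanProx.variational {α : ℝ} (hα : 0 < α) {Δ : StrongDual ℝ E} {y z u : E}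
    (hg : ProperConvexLSC K g) (hf : IsDistanceGenerating K g f gradf)
    (hdom : effDom K g ⊆ domSubdiff K f) (hcont : ContinuousOn gradf (effDom K g))
    (hz : IsBregmanProx K g f gradf α Δ y z) (hu : u ∈ effDom K g) :
    α * ((g z).toReal - (g u).toReal) + α * Δ (z - u) ≤ (gradf z - gradf y) (u - z) := by
  have hzd := hz.mem_effDom hα hg hu
  -- Compare `z` with `z + t(u - z)`. The change of `g` is bounded by convexity and that of `f` by
  -- the gradient inequality at the moved point, so after division by `t` only continuity of `gradf`
  -- is needed as `t → 0`.
  have hmain : ∀ t ∈ Set.Ioc (0 : ℝ) 1,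
      α * ((g z).toReal - (g u).toReal) + α * Δ (z - u)
        ≤ (gradf (z + t • (u - z)) - gradf y) (u - z) := by
    rintro t ⟨ht0, ht1⟩
    obtain ⟨hd, hle⟩ := hg.segment hzd hu ht0.le ht1
    have h := hz.2 _ hd.1
    rw [proxObjective, proxObjective, ← hg.coe_toReal hzd, ← hg.coe_toReal hd] at h
    have h' : α * (g z).toReal + (α * Δ z + bregman f gradf z y)
        ≤ α * (g (z + t • (u - z))).toReal
          + (α * Δ (z + t • (u - z)) + bregman f gradf (z + t • (u - z)) y) := by
      exact_mod_cast h
    have hb := hf.bregman_nonneg hzd (hdom hd)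
    have hα' := mul_le_mul_of_nonneg_left hle hα.le
    simp only [bregman, map_add, map_sub, map_smul, smul_eq_mul,
      sub_apply] at h' hb ⊢
    refine le_of_mul_le_mul_left ?_ ht0
    linarith
  have hpath : Tendsto (fun t : ℝ => z + t • (u - z)) (𝓝[>] 0) (𝓝[effDom K g] z) := by
    refine tendsto_nhdsWithin_iff.2 ⟨?_, ?_⟩
    · have : Continuous fun t : ℝ => z + t • (u - z) := by fun_prop
      simpa using (this.tendsto 0).mono_left nhdsWithin_le_nhds
    · filter_upwards [Ioc_mem_nhdsGT (zero_lt_one' ℝ)] with t ht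
      exact (hg.segment hzd hu ht.1.le ht.2).1
  have hlim : Tendsto (fun t : ℝ => (gradf (z + t • (u - z)) - gradf y) (u - z)) (𝓝[>] 0)
      (𝓝 ((gradf z - gradf y) (u - z))) :=
    ((ContinuousLinearMap.apply ℝ ℝ (u - z)).continuous.tendsto _).comp
      (((hcont z hzd).tendsto.comp hpath).sub_const _)
  exact ge_of_tendsto hlim
    (by filter_upwards [Ioc_mem_nhdsGT (zero_lt_one' ℝ)] with t ht using hmain t ht)

/-- The proximal point depends on the centre `y` through `gradf y` only. -/
theorem IsBregmanProx.unique {α : ℝ} (hα : 0 < α) {Δ : StrongDual ℝ E} {y y' z z' u : E}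
    (hg : ProperConvexLSC K g) (hf : IsDistanceGenerating K g f gradf)
    (hdom : effDom K g ⊆ domSubdiff K f) (hcont : ContinuousOn gradf (effDom K g))
    (hu : u ∈ effDom K g)
    (hz : IsBregmanProx K g f gradf α Δ y z) (hz' : IsBregmanProx K g f gradf α Δ y' z')
    (hy : gradf y = gradf y') : z = z' := by
  have hd := hz.mem_effDom hα hg hu
  have hd' := hz'.mem_effDom hα hg hu
  -- Each minimizer is tested against the other. In the sum the `g` and `Δ` terms cancel, leaving
  -- `D(z, z') + D(z', z) ≤ 0`, whereas strong convexity bounds this sum below by `‖z - z'‖²`.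
  have h1 := hz.variational hα hg hf hdom hcont hd'
  have h2 := hz'.variational hα hg hf hdom hcont hd
  have h3 := hf.sq_le_bregman hd (hdom hd')
  have h4 := hf.sq_le_bregman hd' (hdom hd)
  rw [norm_sub_rev z' z] at h4
  have h5 := bregman_symm_add (f := f) (gradf := gradf) z z'
  rw [hy] at h1
  simp only [map_sub, sub_apply] at h1 h2 h5
  have : ‖z - z'‖ ^ 2 ≤ 0 := by linarith
  exact sub_eq_zero.1 (norm_eq_zero.1 (pow_eq_zero_iff two_ne_zero |>.1
    (le_antisymm this (sq_nonneg _))))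

theorem solutionSet_le (hg : ProperConvexLSC K g) {z u : E} (hz : z ∈ solutionSet K g F)
    (hu : u ∈ effDom K g) : 0 ≤ F z (u - z) + (g u).toReal - (g z).toReal := by
  have h := hz.2 u hu.1
  rw [← hg.coe_toReal hu, ← hg.coe_toReal hz.1] at h
  exact_mod_cast h

/-- The Lyapunov function of the method, for the solution `u`, the current point `x` and the
previous point `x'`. -/
noncomputable def lyapunov (f : E → EReal) (gradf F : E → StrongDual ℝ E) (γ α : ℝ)
    (u x x' : E) : ℝ :=
  bregman f gradf u x + (1 - γ) * bregman f gradf u x' - α * (F x - F x') (x - u)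
    + (γ - α) / 2 * ‖x - x'‖ ^ 2

/-- Only the cross term can be negative. It is at least `-(‖x - u‖² / 4 + α² L² ‖x - x'‖²)`: the
first part takes half of the strong convexity bound for `D(u, x)`, and the second is absorbed
because `hα2` says `α² L² ≤ (γ - α) / 2`. -/
theorem sq_le_lyapunov {γ α L : ℝ} (hγ1 : γ ≤ 1) (hα : 0 < α)
    (hα2 : 2 * L ^ 2 * α ^ 2 + α ≤ γ) (hf : IsDistanceGenerating K g f gradf)
    (hdom : effDom K g ⊆ domSubdiff K f) (hL : LipschitzOperatorOn (effDom K g) F L)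
    {u x x' : E} (hu : u ∈ effDom K g) (hx : x ∈ effDom K g) (hx' : x' ∈ effDom K g) :
    1 / 4 * ‖x - u‖ ^ 2 ≤ lyapunov f gradf F γ α u x x' := by
  have h1 := hf.sq_le_bregman hu (hdom hx)
  rw [norm_sub_rev] at h1
  have h2 := mul_nonneg (sub_nonneg.2 hγ1) (hf.bregman_nonneg hu (hdom hx'))
  have h3 : (F x - F x') (x - u) ≤ L * ‖x - x'‖ * ‖x - u‖ :=
    (le_abs_self _).trans (((F x - F x').le_opNorm _).trans
      (mul_le_mul_of_nonneg_right (hL x hx x' hx') (norm_nonneg _)))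
  have h4 := mul_le_mul_of_nonneg_left h3 hα.le
  have h5 := mul_le_mul_of_nonneg_right hα2 (sq_nonneg ‖x - x'‖)
  unfold lyapunov
  nlinarith [sq_nonneg (1 / 2 * ‖x - u‖ - α * L * ‖x - x'‖)]

/-- The correction `-α (F z - F x)(z - u)` turns the `F x` of the proximal inequality into `F z`,
which monotonicity compares with `F u`. The error `A(z - x)` costs `α/2 * ‖z - x‖²`; with the weight
`(γ - α)/2` this is exactly the `γ/2 * ‖z - x‖²` gained from `D(z, x)`. -/
theorem lyapunov_step {γ α : ℝ} (hγ0 : 0 < γ) (hγ1 : γ ≤ 1) (hα : 0 < α)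
    (hg : ProperConvexLSC K g) (hf : IsDistanceGenerating K g f gradf)
    (hdom : effDom K g ⊆ domSubdiff K f) (hcont : ContinuousOn gradf (effDom K g))
    (hF : MonotoneOperatorOn (effDom K g) F)
    {u x x' y z : E} {A : StrongDual ℝ E} (hu : u ∈ solutionSet K g F) (hx : x ∈ effDom K g)
    (hx' : x' ∈ effDom K g) (hy : gradf y = γ • gradf x + (1 - γ) • gradf x')
    (hz : IsBregmanProx K g f gradf α (F x + A) y z) :
    lyapunov f gradf F γ α u z x ≤ lyapunov f gradf F γ α u x x' - (γ - α) / 2 * ‖x - x'‖ ^ 2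
      + α * (-(A - (F x - F x')) (x - u) + 1 / 2 * ‖A‖ ^ 2) := by
  have hzd := hz.mem_effDom hα hg hx
  have h1 := hz.variational hα hg hf hdom hcont hu.1
  have h2 : (gradf z - gradf y) (u - z)
      = γ * (gradf z - gradf x) (u - z) + (1 - γ) * (gradf z - gradf x') (u - z) := by
    rw [hy]
    simp only [sub_apply, add_apply,
      smul_apply, smul_eq_mul]
    ring
  rw [h2, bregman_three_point (f := f), bregman_three_point (f := f)] at h1
  have h3 := mul_le_mul_of_nonneg_left (hf.sq_le_bregman hzd (hdom hx)) hγ0.le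
  have h4 := mul_nonneg (sub_nonneg.2 hγ1) (hf.bregman_nonneg hzd (hdom hx'))
  have h5 := mul_nonneg hα.le (solutionSet_le hg hu hzd)
  have h6 := mul_nonneg hα.le (hF z hzd u hu.1)
  have h7 : -(A (z - x)) ≤ 1 / 2 * ‖A‖ ^ 2 + 1 / 2 * ‖z - x‖ ^ 2 := by
    have := (neg_le_abs _).trans (A.le_opNorm (z - x))
    nlinarith [sq_nonneg (‖A‖ - ‖z - x‖)]
  have h8 := mul_le_mul_of_nonneg_left h7 hα.le
  unfold lyapunov
  simp only [map_sub, sub_apply, add_apply] at *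
  nlinarith

end Deterministic

/-! ### Pathwise convergence from vanishing increments and convergent Bregman distances. -/

section Limit

variable {E : Type*} [NormedAddCommGroup E] [NormedSpace ℝ E]
  {K : Set E} {g f : E → EReal} {gradf : E → StrongDual ℝ E} {F : E → StrongDual ℝ E}

theorem LipschitzOperatorOn.continuousOn {C : Set E} {L : ℝ} (hF : LipschitzOperatorOn C F L) :
    ContinuousOn F C := by
  refine LipschitzOnWith.continuousOn (K := L.toNNReal)
    (LipschitzOnWith.of_dist_le_mul fun x hx y hy => ?_)
  rw [dist_eq_norm, dist_eq_norm]
  exact (hF x hx y hy).trans (mul_le_mul_of_nonneg_right (Real.le_coe_toNNReal L) (norm_nonneg _))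

/-- Up to a term that does not depend on the sequences, the Bregman distance is affine in its
first argument, so its convergence extends to affine spans. -/
theorem exists_tendsto_bregman_of_mem_affineSpan {t : Set E} {c : ℝ} {y y' : ℕ → E}
    (ht : ∀ u ∈ t, ∃ l, Tendsto
      (fun s => bregman f gradf u (y s) + c * bregman f gradf u (y' s)) atTop (𝓝 l))
    {u : E} (hu : u ∈ affineSpan ℝ t) :
    ∃ l, Tendsto (fun s => bregman f gradf u (y s) + c * bregman f gradf u (y' s))
      atTop (𝓝 l) := by
  have key : ∃ l, Tendsto (fun s => bregman f gradf u (y s) + c * bregman f gradf u (y' s)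
      - (1 + c) * (f u).toReal) atTop (𝓝 l) := by
    refine affineSpan_induction (p := fun u => ∃ l, Tendsto
      (fun s => bregman f gradf u (y s) + c * bregman f gradf u (y' s)
      - (1 + c) * (f u).toReal) atTop (𝓝 l)) hu ?_ ?_
    · intro v hv
      obtain ⟨l, hl⟩ := ht v hv
      exact ⟨_, hl.sub_const _⟩
    · rintro a v₁ v₂ v₃ ⟨l₁, h₁⟩ ⟨l₂, h₂⟩ ⟨l₃, h₃⟩
      refine ⟨_, (((h₁.sub h₂).const_mul a).add h₃).congr fun s => ?_⟩
      simp only [bregman, vsub_eq_sub, vadd_eq_add, map_add, map_sub, map_smul, smul_eq_mul]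
      ring
  obtain ⟨l, hl⟩ := key
  exact ⟨_, (hl.add_const ((1 + c) * (f u).toReal)).congr fun s => by ring⟩

theorem tendsto_strongDual_apply {ι : Type*} {l : Filter ι} {A : ι → StrongDual ℝ E} {v : ι → E}
    {A₀ : StrongDual ℝ E} {v₀ : E} (hA : Tendsto A l (𝓝 A₀)) (hv : Tendsto v l (𝓝 v₀)) :
    Tendsto (fun i => A i (v i)) l (𝓝 (A₀ v₀)) :=
  (isBoundedBilinearMap_apply.continuous.tendsto (A₀, v₀)).comp (hA.prodMk_nhds hv)

theorem tendsto_apply_of_bounded {A : ℕ → StrongDual ℝ E} {v : ℕ → E} {R : ℝ}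
    (hA : Tendsto A atTop (𝓝 0)) (hv : ∀ s, ‖v s‖ ≤ R) :
    Tendsto (fun s => A s (v s)) atTop (𝓝 0) := by
  refine squeeze_zero_norm (a := fun s => ‖A s‖ * R) (fun s => ?_) ?_
  · exact ((A s).le_opNorm _).trans (mul_le_mul_of_nonneg_left (hv s) (norm_nonneg _))
  · simpa using hA.norm.mul_const R

/-- Convergence of the Lyapunov function at a solution forces boundedness of the iterates and
convergence of the Bregman distances. -/
theorem exists_tendsto_bregman_of_lyapunov {γ α L : ℝ} (hγ1 : γ ≤ 1) (hα : 0 < α)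
    (hα2 : 2 * L ^ 2 * α ^ 2 + α ≤ γ) (hf : IsDistanceGenerating K g f gradf)
    (hdom : effDom K g ⊆ domSubdiff K f) (hL : LipschitzOperatorOn (effDom K g) F L)
    {u : E} (hu : u ∈ effDom K g) {z z' : ℕ → E} (hz : ∀ s, z s ∈ effDom K g)
    (hz' : ∀ s, z' s ∈ effDom K g)
    (hstep : Tendsto (fun s => ‖z s - z' s‖) atTop (𝓝 0))
    (hlyap : ∃ l, Tendsto (fun s => lyapunov f gradf F γ α u (z s) (z' s)) atTop (𝓝 l)) :
    ∃ l, Tendsto (fun s => bregman f gradf u (z s) + (1 - γ) * bregman f gradf u (z' s))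
      atTop (𝓝 l) := by
  obtain ⟨l, hl⟩ := hlyap
  obtain ⟨B, hB⟩ := hl.bddAbove_range
  -- From `t²/4 ≤ B`, the inequality `t ≤ t² + 1/4` gives a bound without a square root.
  have hbd : ∀ s, ‖z s - u‖ ≤ 1 + 4 * B := fun s => by
    have h1 := sq_le_lyapunov hγ1 hα hα2 hf hdom hL hu (hz s) (hz' s)
    have h2 := hB ⟨s, rfl⟩
    nlinarith [sq_nonneg (‖z s - u‖ - 1 / 2)]
  have hFd : Tendsto (fun s => F (z s) - F (z' s)) atTop (𝓝 0) := by
    refine squeeze_zero_norm (fun s => hL _ (hz s) _ (hz' s)) ?_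
    simpa using hstep.const_mul L
  have h3 := (tendsto_apply_of_bounded hFd hbd).const_mul α
  have h4 := (hstep.pow 2).const_mul ((γ - α) / 2)
  exact ⟨_, ((hl.add h3).sub h4).congr fun s => by unfold lyapunov; ring⟩

theorem tendsto_solution [FiniteDimensional ℝ E] {γ α L : ℝ} (hγ0 : 0 < γ) (hγ1 : γ ≤ 1)
    (hα : 0 < α) (hK : IsClosed K)
    (hg : ProperConvexLSC K g) (hf : IsDistanceGenerating K g f gradf)
    (hdom : effDom K g ⊆ domSubdiff K f) (hcont : ContinuousOn gradf (effDom K g))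
    (hL : LipschitzOperatorOn (effDom K g) F L)
    {z y : ℕ → E} {A : ℕ → StrongDual ℝ E} (hz : ∀ s, z s ∈ effDom K g)
    (hy : ∀ s, gradf (y s) = γ • gradf (z s) + (1 - γ) • gradf (prev z s))
    (hprox : ∀ s, IsBregmanProx K g f gradf α (F (z s) + A s) (y s) (z (s + 1)))
    (hstep : Tendsto (fun s => ‖z s - prev z s‖) atTop (𝓝 0)) (hA : Tendsto A atTop (𝓝 0))
    (hne : (solutionSet K g F).Nonempty)
    (hconv : ∀ u ∈ solutionSet K g F, ∃ l, Tendsto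
      (fun s => bregman f gradf u (z s) + (1 - γ) * bregman f gradf u (prev z s))
      atTop (𝓝 l)) :
    ∃ zt ∈ solutionSet K g F, Tendsto z atTop (𝓝 zt) := by
  have hz' : ∀ s, prev z s ∈ effDom K g := fun s => by
    cases s
    exacts [hz 0, hz _]
  have hDle : ∀ u ∈ effDom K g, ∀ s, bregman f gradf u (z s)
      ≤ bregman f gradf u (z s) + (1 - γ) * bregman f gradf u (prev z s) := fun u hu s =>
    le_add_of_nonneg_right (mul_nonneg (sub_nonneg.2 hγ1) (hf.bregman_nonneg hu (hdom (hz' s))))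
  have hsq : ∀ u ∈ effDom K g, ∀ s, ‖z s - u‖ ^ 2
      ≤ 2 * (bregman f gradf u (z s) + (1 - γ) * bregman f gradf u (prev z s)) := by
    intro u hu s
    have h1 := hf.sq_le_bregman hu (hdom (hz s))
    rw [norm_sub_rev] at h1
    linarith [hDle u hu s]
  have hvar : ∀ u ∈ effDom K g, ∀ s, (g (z (s + 1))).toReal ≤ (g u).toReal
      - (F (z s) + A s) (z (s + 1) - u) + α⁻¹ * (gradf (z (s + 1)) - gradf (y s)) (u - z (s + 1)) := by
    intro u hu s
    have h := mul_le_mul_of_nonneg_left ((hprox s).variational hα hg hf hdom hcont hu)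
      (inv_nonneg.2 hα.le)
    rw [mul_add, inv_mul_cancel_left₀ hα.ne', inv_mul_cancel_left₀ hα.ne'] at h
    linarith
  -- the iterates are bounded and have a cluster point
  obtain ⟨u₀, hu₀⟩ := hne
  obtain ⟨l₀, hl₀⟩ := hconv u₀ hu₀
  obtain ⟨B, hB⟩ := hl₀.bddAbove_range
  have hB' : ∀ s, bregman f gradf u₀ (z s) + (1 - γ) * bregman f gradf u₀ (prev z s) ≤ B :=
    fun s => hB ⟨s, rfl⟩
  have hbd : ∀ s, ‖z s - u₀‖ ≤ 1 + 2 * B := fun s => by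
    nlinarith [sq_nonneg (‖z s - u₀‖ - 1 / 2), hsq u₀ hu₀.1 s, hB' s]
  obtain ⟨zt, -, φ, hφ, hzφ⟩ := (isCompact_closedBall u₀ (1 + 2 * B)).tendsto_subseq
    (x := z) fun s => by simpa [dist_eq_norm] using hbd s
  have hdiff : Tendsto (fun s => z (s + 1) - z s) atTop (𝓝 0) :=
    tendsto_zero_iff_norm_tendsto_zero.2 ((tendsto_add_atTop_iff_nat 1).2 hstep)
  have hdiff' : Tendsto (fun s => z s - prev z s) atTop (𝓝 0) :=
    tendsto_zero_iff_norm_tendsto_zero.2 hstep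
  have hzφ1 : Tendsto (fun k => z (φ k + 1)) atTop (𝓝 zt) := by
    simpa using hzφ.add (hdiff.comp hφ.tendsto_atTop)
  have hzφ' : Tendsto (fun k => prev z (φ k)) atTop (𝓝 zt) := by
    simpa using hzφ.sub (hdiff'.comp hφ.tendsto_atTop)
  have hztK : zt ∈ K := hK.mem_of_tendsto hzφ (Eventually.of_forall fun k => (hz _).1)
  have hAφ : Tendsto (fun k => A (φ k)) atTop (𝓝 0) := hA.comp hφ.tendsto_atTop
  -- the cluster point lies in the domain
  have hFbd : ∀ s, ‖F (z s)‖ ≤ ‖F u₀‖ + |L| * (1 + 2 * B) := fun s => by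
    have h1 := hL _ (hz s) _ hu₀.1
    have h2 : L * ‖z s - u₀‖ ≤ |L| * (1 + 2 * B) :=
      mul_le_mul (le_abs_self L) (hbd s) (norm_nonneg _) (abs_nonneg L)
    linarith [norm_le_norm_add_norm_sub' (F (z s)) (F u₀)]
  obtain ⟨B₂, hB₂⟩ := hA.norm.bddAbove_range
  have hztg : zt ∈ effDom K g := by
    refine ⟨hztK, lt_of_le_of_lt (hg.le_of_tendsto (r := fun _ => (g u₀).toReal
      + (‖F u₀‖ + |L| * (1 + 2 * B) + B₂) * (1 + 2 * B) + α⁻¹ * B) (fun k => (hz (φ k + 1)).1)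
      hztK hzφ1 tendsto_const_nhds fun k => ?_) (EReal.coe_lt_top _)⟩
    rw [← hg.coe_toReal (hz (φ k + 1)), EReal.coe_le_coe_iff]
    set s := φ k
    have h1 := hvar u₀ hu₀.1 s
    have h2 : -(F (z s) + A s) (z (s + 1) - u₀)
        ≤ (‖F u₀‖ + |L| * (1 + 2 * B) + B₂) * (1 + 2 * B) := by
      refine (neg_le_abs _).trans (((F (z s) + A s).le_opNorm _).trans ?_)
      have h3 : ‖F (z s) + A s‖ ≤ ‖F u₀‖ + |L| * (1 + 2 * B) + B₂ :=
        (norm_add_le _ _).trans (add_le_add (hFbd s) (hB₂ ⟨s, rfl⟩))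
      exact mul_le_mul h3 (hbd (s + 1)) (norm_nonneg _) ((norm_nonneg _).trans h3)
    -- The limit is not yet known to lie in `dom g`, so continuity of `gradf` is unavailable there.
    -- The three-point identity replaces the gradients by Bregman distances from `u₀`, which `B`
    -- controls.
    have h4 : (gradf (z (s + 1)) - gradf (y s)) (u₀ - z (s + 1)) ≤ B := by
      have e : (gradf (z (s + 1)) - gradf (y s)) (u₀ - z (s + 1))
          = γ * (gradf (z (s + 1)) - gradf (z s)) (u₀ - z (s + 1))
            + (1 - γ) * (gradf (z (s + 1)) - gradf (prev z s)) (u₀ - z (s + 1)) := by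
        rw [hy]
        simp only [sub_apply, add_apply, smul_apply, smul_eq_mul]
        ring
      rw [e, bregman_three_point (f := f), bregman_three_point (f := f)]
      have h5 := hf.bregman_nonneg hu₀.1 (hdom (hz (s + 1)))
      have h6 := mul_nonneg hγ0.le (hf.bregman_nonneg (hz (s + 1)) (hdom (hz s)))
      have h7 := mul_nonneg (sub_nonneg.2 hγ1)
        (hf.bregman_nonneg (hz (s + 1)) (hdom (hz' s)))
      have h8 := mul_nonneg (sub_nonneg.2 hγ1) (hf.bregman_nonneg hu₀.1 (hdom (hz s)))
      linarith [hB' s]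
    have h9 := mul_le_mul_of_nonneg_left h4 (inv_nonneg.2 hα.le)
    linarith
  have hmem : ∀ {v : ℕ → E}, (∀ k, v k ∈ effDom K g) → Tendsto v atTop (𝓝 zt) →
      Tendsto v atTop (𝓝[effDom K g] zt) := fun h1 h2 =>
    tendsto_nhdsWithin_iff.2 ⟨h2, Eventually.of_forall h1⟩
  have hG : Tendsto (fun k => gradf (z (φ k))) atTop (𝓝 (gradf zt)) :=
    (hcont zt hztg).tendsto.comp (hmem (fun k => hz _) hzφ)
  have hG1 : Tendsto (fun k => gradf (z (φ k + 1))) atTop (𝓝 (gradf zt)) :=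
    (hcont zt hztg).tendsto.comp (hmem (fun k => hz _) hzφ1)
  have hG' : Tendsto (fun k => gradf (prev z (φ k))) atTop (𝓝 (gradf zt)) :=
    (hcont zt hztg).tendsto.comp (hmem (fun k => hz' _) hzφ')
  have hFφ : Tendsto (fun k => F (z (φ k))) atTop (𝓝 (F zt)) :=
    (hL.continuousOn zt hztg).tendsto.comp (hmem (fun k => hz _) hzφ)
  have hGy : Tendsto (fun k => gradf (z (φ k + 1)) - gradf (y (φ k))) atTop (𝓝 0) := by
    have h := hG1.sub ((hG.const_smul γ).add (hG'.const_smul (1 - γ)))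
    rw [← add_smul, add_sub_cancel, one_smul, sub_self] at h
    exact h.congr fun k => by rw [hy]
  -- the cluster point solves the variational inequality
  have hsol : zt ∈ solutionSet K g F := by
    refine ⟨hztg, fun u huK => ?_⟩
    by_cases hu : u ∈ effDom K g
    · have hr : Tendsto (fun k => (g u).toReal - (F (z (φ k)) + A (φ k)) (z (φ k + 1) - u)
          + α⁻¹ * (gradf (z (φ k + 1)) - gradf (y (φ k))) (u - z (φ k + 1))) atTop
          (𝓝 ((g u).toReal - (F zt + 0) (zt - u)
            + α⁻¹ * (0 : StrongDual ℝ E) (u - zt))) :=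
        (tendsto_const_nhds.sub (tendsto_strongDual_apply (hFφ.add hAφ) (hzφ1.sub_const u))).add
          ((tendsto_strongDual_apply hGy (tendsto_const_nhds.sub hzφ1)).const_mul _)
      have h := hg.le_of_tendsto (fun k => (hz (φ k + 1)).1) hztK hzφ1 hr fun k => by
        rw [← hg.coe_toReal (hz (φ k + 1)), EReal.coe_le_coe_iff]
        exact hvar u hu (φ k)
      rw [← hg.coe_toReal hztg, EReal.coe_le_coe_iff] at h
      rw [← hg.coe_toReal hztg, ← hg.coe_toReal hu]
      have h' : 0 ≤ F zt (u - zt) + (g u).toReal - (g zt).toReal := by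
        simp only [add_zero, zero_apply, map_sub] at h ⊢
        linarith
      exact_mod_cast h'
    · have htop : g u = ⊤ := not_lt_top_iff.1 fun h => hu ⟨huK, h⟩
      rw [htop, ← hg.coe_toReal hztg, EReal.coe_add_top, EReal.top_sub_coe]
      exact le_top
  -- the whole sequence converges to the cluster point
  refine ⟨zt, hsol, ?_⟩
  obtain ⟨l, hl⟩ := hconv zt hsol
  -- Adding the nonnegative `D(v, zt)` leaves a pairing of gradients, so continuity of `gradf`
  -- suffices.
  have hDlim : ∀ {v : ℕ → E}, (∀ k, v k ∈ effDom K g) → Tendsto v atTop (𝓝 zt) →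
      Tendsto (fun k => bregman f gradf zt (v k)) atTop (𝓝 0) := by
    intro v h1 h2
    have h3 : Tendsto (fun k => (gradf zt - gradf (v k)) (zt - v k)) atTop (𝓝 0) := by
      have h := tendsto_strongDual_apply
        (((hcont zt hztg).tendsto.comp (hmem h1 h2)).const_sub (gradf zt)) (h2.const_sub zt)
      simpa using h
    refine squeeze_zero (fun k => hf.bregman_nonneg hztg (hdom (h1 k))) (fun k => ?_) h3
    rw [← bregman_symm_add (f := f)]
    exact le_add_of_nonneg_right (hf.bregman_nonneg (h1 k) (hdom hztg))
  have hl0 : l = 0 := by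
    have h1 := (hDlim (fun k => hz (φ k)) hzφ).add
      ((hDlim (fun k => hz' (φ k)) hzφ').const_mul (1 - γ))
    rw [mul_zero, add_zero] at h1
    exact tendsto_nhds_unique (hl.comp hφ.tendsto_atTop) h1
  rw [hl0] at hl
  refine tendsto_iff_norm_sub_tendsto_zero.2 ?_
  have h := squeeze_zero (fun s => sq_nonneg _) (hsq zt hztg)
    (by simpa using hl.const_mul 2)
  simpa using h.sqrt

end Limit

/-! ### Finitely valued random variables. -/

section Simple

variable {Ω β β' : Type*}

/-- `T` is a simple function for the σ-algebra `m`. -/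
def IsSimple (m : MeasurableSpace Ω) (T : Ω → β) : Prop := ∃ S : @SimpleFunc Ω m β, ⇑S = T

theorem IsSimple.comp {m : MeasurableSpace Ω} {T : Ω → β} (hT : IsSimple m T) (φ : β → β') :
    IsSimple m fun ω => φ (T ω) := by
  obtain ⟨S, rfl⟩ := hT
  exact ⟨S.map φ, rfl⟩

theorem IsSimple.prodMk {m : MeasurableSpace Ω} {T : Ω → β} {T' : Ω → β'} (hT : IsSimple m T)
    (hT' : IsSimple m T') : IsSimple m fun ω => (T ω, T' ω) := by
  obtain ⟨S, rfl⟩ := hT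
  obtain ⟨S', rfl⟩ := hT'
  exact ⟨S.pair S', rfl⟩

theorem IsSimple.mono {m m' : MeasurableSpace Ω} {T : Ω → β} (hT : IsSimple m T) (h : m ≤ m') :
    IsSimple m' T := by
  obtain ⟨S, rfl⟩ := hT
  exact ⟨@SimpleFunc.mk Ω m' β S (fun a => h _ (@SimpleFunc.measurableSet_fiber Ω β m S a))
    (@SimpleFunc.finite_range Ω β m S), rfl⟩

theorem IsSimple.stronglyMeasurable {m : MeasurableSpace Ω} [TopologicalSpace β] {T : Ω → β}
    (hT : IsSimple m T) : StronglyMeasurable[m] T := by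
  obtain ⟨S, rfl⟩ := hT
  exact S.stronglyMeasurable

theorem IsSimple.integrable {m : MeasurableSpace Ω} {μ : Measure Ω} [IsFiniteMeasure μ]
    {T : Ω → ℝ} (hT : IsSimple m T) : Integrable T μ := by
  obtain ⟨S, rfl⟩ := hT
  exact S.integrable_of_isFiniteMeasure

theorem IsSimple.of_stronglyMeasurable {m : MeasurableSpace Ω} [TopologicalSpace β]
    [TopologicalSpace.MetrizableSpace β] {T : Ω → β} (hT : StronglyMeasurable[m] T)
    (hfin : (Set.range T).Finite) : IsSimple m T :=
  ⟨@SimpleFunc.mk Ω m β T (fun _ => hT.measurableSet_eq_fun stronglyMeasurable_const) hfin, rfl⟩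

theorem IsSimple.of_measurable {m : MeasurableSpace Ω} [MeasurableSpace β]
    [MeasurableSingletonClass β] [Finite β] {T : Ω → β} (hT : Measurable T) : IsSimple m T :=
  ⟨⟨T, fun a => hT (measurableSet_singleton a), Set.toFinite _⟩, rfl⟩

theorem finite_range_of_determined {T : Ω → β} {T' : Ω → β'} (hT : (Set.range T).Finite)
    (h : ∀ ω ω', T ω = T ω' → T' ω = T' ω') : (Set.range T').Finite := by
  rcases isEmpty_or_nonempty Ω with hΩ | ⟨⟨ω₀⟩⟩
  · exact Set.toFinite _
  · have hf : T'.FactorsThrough T := fun ω ω' hω => h ω ω' hω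
    have : T' = Function.extend T T' (fun _ => T' ω₀) ∘ T := by
      ext ω
      exact (hf.extend_apply _ ω).symm
    rw [this, Set.range_comp]
    exact hT.image _

end Simple

/-! ### Freezing, summable expectations and nonnegative supermartingales. -/

section Probability

variable {Ω : Type*} {mΩ : MeasurableSpace Ω} {μ : Measure Ω}

/-- Freezing: the conditional expectation of a function of an `m`-simple state and of a discrete
variable whose conditional law given `m` is `q`. -/
theorem condExp_of_condLaw [IsFiniteMeasure μ] {β ι : Type*} [Fintype ι] [MeasurableSpace ι]
    [MeasurableSingletonClass ι] {m : MeasurableSpace Ω} (hm : m ≤ mΩ) {T : Ω → β}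
    (hT : IsSimple m T) {η : Ω → ι} (hη : Measurable[mΩ] η) {q : β → ι → ℝ}
    (hq : ∀ i, μ[Set.indicator {ω | η ω = i} (fun _ => (1 : ℝ)) | m]
      =ᵐ[μ] fun ω => q (T ω) i) (v : β → ι → ℝ) :
    μ[fun ω => v (T ω) (η ω) | m] =ᵐ[μ] fun ω => ∑ i, q (T ω) i * v (T ω) i := by
  classical
  have hset : ∀ i, MeasurableSet[mΩ] {ω | η ω = i} := fun i => hη (measurableSet_singleton i)
  have hind : ∀ i, Integrable (Set.indicator {ω | η ω = i} (fun _ => (1 : ℝ))) μ := fun i =>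
    (integrable_const 1).indicator (hset i)
  have hprod : ∀ i, Integrable ((fun ω => v (T ω) i) *
      Set.indicator {ω | η ω = i} (fun _ => (1 : ℝ))) μ := by
    intro i
    have e : ((fun ω => v (T ω) i) * Set.indicator {ω | η ω = i} (fun _ => (1 : ℝ)))
        = Set.indicator {ω | η ω = i} (fun ω => v (T ω) i) := by
      ext ω
      by_cases h : η ω = i <;> simp [h]
    rw [e]
    exact ((hT.mono hm).comp fun t => v t i).integrable.indicator (hset i)
  have hsum : (fun ω => v (T ω) (η ω)) = ∑ i, (fun ω => v (T ω) i) *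
      Set.indicator {ω | η ω = i} (fun _ => (1 : ℝ)) := by
    ext ω
    simp [Finset.sum_apply, Set.indicator_apply]
  rw [hsum]
  refine (condExp_finsetSum (fun i _ => hprod i) m).trans ?_
  have hpull : ∀ᵐ ω ∂μ, ∀ i, (μ[(fun ω => v (T ω) i) *
      Set.indicator {ω | η ω = i} (fun _ => (1 : ℝ)) | m]) ω = v (T ω) i * q (T ω) i := by
    refine ae_all_iff.2 fun i => ?_
    filter_upwards [condExp_mul_of_stronglyMeasurable_left
      ((hT.comp fun t => v t i).stronglyMeasurable) (hprod i) (hind i), hq i] with ω h1 h2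
    rw [h1, Pi.mul_apply, h2]
  filter_upwards [hpull] with ω hω
  rw [Finset.sum_apply]
  exact Finset.sum_congr rfl fun i _ => by rw [hω i, mul_comm]

/-- By Tonelli the series `∑ Y s` has finite integral, hence converges almost everywhere. -/
theorem ae_tendsto_zero_of_sum_integral_le {Y : ℕ → Ω → ℝ} {C : ℝ} (h0 : ∀ s ω, 0 ≤ Y s ω)
    (hint : ∀ s, Integrable (Y s) μ) (hC : ∀ n, ∑ s ∈ Finset.range n, ∫ ω, Y s ω ∂μ ≤ C) :
    ∀ᵐ ω ∂μ, Tendsto (fun s => Y s ω) atTop (𝓝 0) := by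
  have hmeas : ∀ s, AEMeasurable (fun ω => ENNReal.ofReal (Y s ω)) μ := fun s =>
    (hint s).aestronglyMeasurable.aemeasurable.ennreal_ofReal
  have hlt : ∫⁻ ω, ∑' s, ENNReal.ofReal (Y s ω) ∂μ ≠ ⊤ := by
    rw [lintegral_tsum hmeas]
    refine ne_top_of_le_ne_top (ENNReal.ofReal_ne_top (r := C))
      (ENNReal.tsum_le_of_sum_range_le fun n => ?_)
    have : ∀ s ∈ Finset.range n, ∫⁻ ω, ENNReal.ofReal (Y s ω) ∂μ
        = ENNReal.ofReal (∫ ω, Y s ω ∂μ) := fun s _ =>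
      (ofReal_integral_eq_lintegral_ofReal (hint s) (ae_of_all _ (h0 s))).symm
    rw [Finset.sum_congr rfl this,
      ← ENNReal.ofReal_sum_of_nonneg fun s _ => integral_nonneg (h0 s)]
    exact ENNReal.ofReal_le_ofReal (hC n)
  filter_upwards [ae_lt_top' (AEMeasurable.tsum hmeas) hlt] with ω hω
  have h := ENNReal.tendsto_atTop_zero_of_tsum_ne_top hω.ne
  have h' := (ENNReal.tendsto_toReal ENNReal.zero_ne_top).comp h
  simpa [Function.comp_def, ENNReal.toReal_ofReal (h0 _ ω)] using h'

/-- `-Φ` is a submartingale whose `L¹` norms are the expectations of `Φ`, bounded by the initial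
one. -/
theorem Supermartingale.ae_exists_tendsto_of_nonneg [IsFiniteMeasure μ] {ℱ : Filtration ℕ mΩ} {Φ : ℕ → Ω → ℝ}
    (hΦ : Supermartingale Φ ℱ μ) (h0 : ∀ s ω, 0 ≤ Φ s ω) :
    ∀ᵐ ω ∂μ, ∃ l, Tendsto (fun s => Φ s ω) atTop (𝓝 l) := by
  have hbdd : ∀ n, eLpNorm ((-Φ) n) 1 μ ≤ ((∫ ω, Φ 0 ω ∂μ).toNNReal : NNReal) := by
    intro n
    have h1 : ∫ ω, Φ n ω ∂μ ≤ ∫ ω, Φ 0 ω ∂μ := by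
      simpa using hΦ.setIntegral_le (Nat.zero_le n) MeasurableSet.univ
    rw [Pi.neg_apply, eLpNorm_neg, eLpNorm_one_eq_lintegral_enorm,
      ← ofReal_integral_norm_eq_lintegral_enorm (hΦ.integrable n)]
    have h2 : ∫ ω, ‖Φ n ω‖ ∂μ = ∫ ω, Φ n ω ∂μ :=
      integral_congr_ae (ae_of_all _ fun ω => Real.norm_of_nonneg (h0 n ω))
    rw [h2]
    exact ENNReal.ofReal_le_ofReal h1
  filter_upwards [hΦ.neg.exists_ae_tendsto_of_bdd hbdd] with ω hω
  obtain ⟨l, hl⟩ := hω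
  exact ⟨-l, by simpa using hl.neg⟩

end Probability

/-! ### Mean and mean square of the batch estimator. -/

section Batch

variable {E : Type*} [NormedAddCommGroup E] [NormedSpace ℝ E]

theorem PMF.sum_toReal_eq_one {ι : Type*} [Fintype ι] (q : PMF ι) : ∑ k, (q k).toReal = 1 := by
  rw [← ENNReal.toReal_sum fun k _ => q.apply_ne_top k, ← tsum_fintype (L := .unconditional ι), q.tsum_coe,
    ENNReal.toReal_one]

/-- The expectation of a sample mean over a batch of independent draws. -/
theorem sum_prod_mul_mean {M b : ℕ} (hb : 1 ≤ b) {q : Fin M → ℝ} (hq : ∑ k, q k = 1)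
    (v : Fin M → ℝ) :
    ∑ i : Fin b → Fin M, (∏ j, q (i j)) * ((b : ℝ)⁻¹ * ∑ j, v (i j)) = ∑ k, q k * v k := by
  classical
  have key : ∀ j₀ : Fin b, ∑ i : Fin b → Fin M, (∏ j, q (i j)) * v (i j₀) = ∑ k, q k * v k := by
    intro j₀
    -- Written as a product over coordinates, the sum factorizes, and every factor with `j ≠ j₀` is
    -- `∑ q = 1`.
    have h1 : ∀ i : Fin b → Fin M, (∏ j, q (i j)) * v (i j₀)
        = ∏ j, q (i j) * (if j = j₀ then v (i j) else 1) := fun i => by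
      rw [Finset.prod_mul_distrib, Finset.prod_ite_eq' Finset.univ j₀ fun j => v (i j)]
      simp
    rw [Finset.sum_congr rfl fun i _ => h1 i,
      ← Fintype.prod_sum fun (j : Fin b) k => q k * (if j = j₀ then v k else 1),
      Finset.prod_eq_single j₀]
    · simp
    · intro j _ hj
      simp [hj, hq]
    · simp
  have hb' : (b : ℝ) ≠ 0 := by positivity
  calc _ = (b : ℝ)⁻¹ * ∑ j₀ : Fin b, ∑ i : Fin b → Fin M, (∏ j, q (i j)) * v (i j₀) := by
        rw [Finset.sum_comm, Finset.mul_sum]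
        refine Finset.sum_congr rfl fun i _ => ?_
        rw [← Finset.mul_sum]
        ring
    _ = _ := by simp [key, hb']

theorem norm_mean_sq_le {V : Type*} [SeminormedAddCommGroup V] [NormedSpace ℝ V] {b : ℕ}
    (a : Fin b → V) : ‖(b : ℝ)⁻¹ • ∑ j, a j‖ ^ 2 ≤ (b : ℝ)⁻¹ * ∑ j, ‖a j‖ ^ 2 := by
  rw [norm_smul, mul_pow, Real.norm_of_nonneg (by positivity)]
  rcases Nat.eq_zero_or_pos b with rfl | hb
  · simp
  have h : ‖∑ j, a j‖ ^ 2 ≤ b * ∑ j, ‖a j‖ ^ 2 :=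
    (pow_le_pow_left₀ (norm_nonneg _) (norm_sum_le _ _) 2).trans
      (by simpa using sq_sum_le_card_mul_sum_sq (s := Finset.univ) (f := fun j => ‖a j‖))
  calc _ ≤ ((b : ℝ)⁻¹) ^ 2 * (b * ∑ j, ‖a j‖ ^ 2) := by gcongr
    _ = _ := by field_simp

/-- The variance-reduction increment `F_ξ(x) - F_ξ(w')` of the oracle chosen at `(x, w')`. -/
noncomputable def oracleIncrement {M : ℕ} (G : E → E → Fin M → E → StrongDual ℝ E) (x w' : E)
    (k : Fin M) : StrongDual ℝ E :=
  G x w' k x - G x w' k w'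

theorem batchEstimator_eq {M b : ℕ} (hb : 1 ≤ b) (F : E → StrongDual ℝ E)
    (G : E → E → Fin M → E → StrongDual ℝ E) (x w w' : E) (i : Fin b → Fin M) :
    batchEstimator F G x w w' i
      = F w + (b : ℝ)⁻¹ • ∑ j, oracleIncrement G x w' (i j) := by
  have hb' : (b : ℝ) ≠ 0 := by positivity
  simp only [batchEstimator, oracleIncrement, add_sub_assoc, Finset.sum_add_distrib, smul_add,
    Finset.sum_const, Finset.card_univ, Fintype.card_fin, ← Nat.cast_smul_eq_nsmul ℝ, smul_smul,
    inv_mul_cancel₀ hb', one_smul]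

/-- The contribution of one sample to the drift of the Lyapunov function. -/
noncomputable def oracleDrift {M : ℕ} (F : E → StrongDual ℝ E)
    (G : E → E → Fin M → E → StrongDual ℝ E) (u x w' : E) (k : Fin M) : ℝ :=
  -(oracleIncrement G x w' k - (F x - F w')) (x - u) + 1 / 2 * ‖oracleIncrement G x w' k‖ ^ 2

/-- The drift is convex in the increment (affine plus a squared norm), so batching reduces to the
single-sample law, with no variance computation. -/
theorem mean_drift_le {M b : ℕ} (hb : 1 ≤ b) (F : E → StrongDual ℝ E)
    (G : E → E → Fin M → E → StrongDual ℝ E) (u x w' : E) (i : Fin b → Fin M) :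
    -((b : ℝ)⁻¹ • ∑ j, oracleIncrement G x w' (i j) - (F x - F w')) (x - u)
        + 1 / 2 * ‖(b : ℝ)⁻¹ • ∑ j, oracleIncrement G x w' (i j)‖ ^ 2
      ≤ (b : ℝ)⁻¹ * ∑ j, oracleDrift F G u x w' (i j) := by
  have hb' : (b : ℝ) ≠ 0 := by positivity
  have h1 := norm_mean_sq_le fun j => oracleIncrement G x w' (i j)
  have h2 : (b : ℝ)⁻¹ * ∑ j, oracleDrift F G u x w' (i j)
      = -((b : ℝ)⁻¹ • ∑ j, oracleIncrement G x w' (i j) - (F x - F w')) (x - u)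
        + 1 / 2 * ((b : ℝ)⁻¹ * ∑ j, ‖oracleIncrement G x w' (i j)‖ ^ 2) := by
    simp only [oracleDrift, Finset.sum_add_distrib, sub_apply, neg_sub, Finset.sum_sub_distrib,
      Finset.sum_const, Finset.card_univ, Fintype.card_fin, smul_apply, sum_apply,
      smul_eq_mul, nsmul_eq_mul, ← Finset.mul_sum]
    field_simp
  rw [h2]
  linarith

/-- Unbiasedness at `x` and at `w'` cancels the linear part; the mean-square Lipschitz bound handles
the quadratic one. -/
theorem IsVariableLipschitzOracle.sum_drift_le {M : ℕ} {C : Set E} {F : E → StrongDual ℝ E}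
    {Q : E → E → PMF (Fin M)} {G : E → E → Fin M → E → StrongDual ℝ E} {Lbar : ℝ}
    (h : IsVariableLipschitzOracle C F Q G Lbar) {u x w' : E} (hx : x ∈ C) (hw : w' ∈ C) :
    ∑ k, (Q x w' k).toReal * oracleDrift F G u x w' k ≤ 1 / 2 * (Lbar ^ 2 * ‖x - w'‖ ^ 2) := by
  have hmean : ∑ k, (Q x w' k).toReal • oracleIncrement G x w' k = F x - F w' := by
    simp only [oracleIncrement, smul_sub, Finset.sum_sub_distrib]
    rw [← h.unbiased x hx w' hw x hx, ← h.unbiased x hx w' hw w' hw]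
  have hmean' := congrArg (fun A : StrongDual ℝ E => A (x - u)) hmean
  have e : ∑ k, (Q x w' k).toReal * oracleDrift F G u x w' k
      = -(∑ k, (Q x w' k).toReal * oracleIncrement G x w' k (x - u))
        + (∑ k, (Q x w' k).toReal) * (F x - F w') (x - u)
        + 1 / 2 * ∑ k, (Q x w' k).toReal * ‖oracleIncrement G x w' k‖ ^ 2 := by
    rw [Finset.sum_mul, Finset.mul_sum, ← Finset.sum_neg_distrib, ← Finset.sum_add_distrib,
      ← Finset.sum_add_distrib]
    refine Finset.sum_congr rfl fun k _ => ?_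
    simp only [oracleDrift, sub_apply]
    ring
  simp only [sum_apply, smul_apply, smul_eq_mul] at hmean'
  rw [e, PMF.sum_toReal_eq_one, hmean']
  have := h.lipschitz x hx w' hw
  unfold oracleIncrement
  linarith

end Batch

theorem prev_induction {β : Type*} {u : ℕ → β} {P : β → Prop} (h : ∀ s, P (u s)) (s : ℕ) :
    P (prev u s) := by
  cases s
  exacts [h 0, h _]

theorem prev_apply {Ω β : Type*} (u : ℕ → Ω → β) (s : ℕ) (ω : Ω) :
    prev u s ω = prev (fun n => u n ω) s := by
  cases s <;> rfl

/-! ### Conditional expectations along a run with `p = 1`. -/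

section Run

variable {E : Type*} [NormedAddCommGroup E] [NormedSpace ℝ E]
  {Ω : Type*} {mΩ : MeasurableSpace Ω} {μ : Measure Ω} {ℱ : Filtration ℕ mΩ} {M b : ℕ}
  {K : Set E} {g f : E → EReal} {gradf : E → StrongDual ℝ E} {F : E → StrongDual ℝ E}
  {Q : E → E → PMF (Fin M)} {G : E → E → Fin M → E → StrongDual ℝ E} {γ p α : ℝ} {x₀ : E}
  {ξ : ℕ → Fin b → Ω → Fin M} {coin : ℕ → Ω → Bool} {x w xbar : ℕ → Ω → E}

theorem IsAlgorithmRun.mem_effDom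
    (hrun : IsAlgorithmRun μ ℱ K g f gradf F Q G γ p α x₀ ξ coin x w xbar)
    (hα : 0 < α) (hg : ProperConvexLSC K g) (hx₀ : x₀ ∈ effDom K g) :
    ∀ s ω, x s ω ∈ effDom K g
  | 0, ω => by rwa [hrun.x_zero]
  | s + 1, ω => (hrun.x_succ s ω).mem_effDom hα hg hx₀

/-- The index and coin sets are finite and the proximal points are unique, so the iterates take
finitely many values. -/
theorem IsAlgorithmRun.finite_range
    (hrun : IsAlgorithmRun μ ℱ K g f gradf F Q G γ p α x₀ ξ coin x w xbar)
    (hα : 0 < α) (hg : ProperConvexLSC K g) (hf : IsDistanceGenerating K g f gradf)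
    (hdom : effDom K g ⊆ domSubdiff K f) (hcont : ContinuousOn gradf (effDom K g))
    (hx₀ : x₀ ∈ effDom K g) (s : ℕ) :
    (Set.range fun ω => ((x s ω, w s ω), (prev x s ω, prev w s ω))).Finite := by
  induction s with
  | zero =>
    refine (Set.finite_singleton ((x₀, x₀), (x₀, x₀))).subset ?_
    rintro _ ⟨ω, rfl⟩
    simp [prev, hrun.x_zero, hrun.w_zero]
  | succ s ih =>
    have hfin : (Set.range fun ω => (((x s ω, w s ω), (prev x s ω, prev w s ω)),
        ((fun j => ξ s j ω), coin s ω))).Finite := by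
      refine (ih.prod (Set.toFinite (Set.univ : Set ((Fin b → Fin M) × Bool)))).subset ?_
      rintro _ ⟨ω, rfl⟩
      exact ⟨⟨ω, rfl⟩, Set.mem_univ _⟩
    refine finite_range_of_determined hfin fun ω ω' h => ?_
    simp only [Prod.mk.injEq] at h
    obtain ⟨⟨⟨hx, hw⟩, hx', hw'⟩, hξ, hc⟩ := h
    have h1 := hrun.x_succ s ω
    have h2 := hrun.x_succ s ω'
    rw [← hx, ← hw, ← hw', ← hξ] at h2
    have hxs : x (s + 1) ω = x (s + 1) ω' :=
      h1.unique hα hg hf hdom hcont hx₀ h2 (by rw [hrun.xbar_eq, hrun.xbar_eq, hx, hx'])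
    simp only [prev, hrun.w_succ, hxs, hx, hw, hc]

/-- Any function of this state, measurable or not, is again simple, hence integrable when
real-valued. -/
theorem IsAlgorithmRun.isSimple
    (hrun : IsAlgorithmRun μ ℱ K g f gradf F Q G γ p α x₀ ξ coin x w xbar)
    (hα : 0 < α) (hg : ProperConvexLSC K g) (hf : IsDistanceGenerating K g f gradf)
    (hdom : effDom K g ⊆ domSubdiff K f) (hcont : ContinuousOn gradf (effDom K g))
    (hx₀ : x₀ ∈ effDom K g) (s : ℕ) :
    IsSimple (ℱ s) fun ω => (x s ω, prev x s ω, prev w s ω) := by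
  have hx : ∀ n, IsSimple (ℱ n) (x n) := fun n =>
    .of_stronglyMeasurable (hrun.adapted_x n) (finite_range_of_determined
      (hrun.finite_range hα hg hf hdom hcont hx₀ n) fun ω ω' h => congrArg (fun t => t.1.1) h)
  have hw : ∀ n, IsSimple (ℱ n) (w n) := fun n =>
    .of_stronglyMeasurable (hrun.adapted_w n) (finite_range_of_determined
      (hrun.finite_range hα hg hf hdom hcont hx₀ n) fun ω ω' h => congrArg (fun t => t.1.2) h)
  refine (hx s).prodMk (IsSimple.prodMk ?_ ?_)
  · cases s
    exacts [hx 0, (hx _).mono (ℱ.mono (Nat.le_succ _))]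
  · cases s
    exacts [hw 0, (hw _).mono (ℱ.mono (Nat.le_succ _))]

variable [IsProbabilityMeasure μ]

theorem IsAlgorithmRun.ae_coin
    (hrun : IsAlgorithmRun μ ℱ K g f gradf F Q G γ p α x₀ ξ coin x w xbar) (hp : p = 1) :
    ∀ᵐ ω ∂μ, ∀ s, coin s ω = true := by
  refine ae_all_iff.2 fun s => ?_
  -- The sampling law is joint in indices and coin, so the event of a failed coin is split over the
  -- finitely many index values.
  have hi : ∀ i : Fin b → Fin M, ∀ᵐ ω ∂μ, ¬((∀ j, ξ s j ω = i j) ∧ coin s ω = false) := by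
    intro i
    have hset : MeasurableSet {ω | (∀ j, ξ s j ω = i j) ∧ coin s ω = false} :=
      (MeasurableSet.iInter fun j => hrun.measurable_index s j (measurableSet_singleton (i j))).inter
        (hrun.measurable_coin s (measurableSet_singleton false)) |>.congr
          (by ext; simp)
    have h0 := hrun.sampling s i false
    simp only [hp, Bool.false_eq_true, if_false, sub_self, mul_zero] at h0
    have h1 := integral_condExp (μ := μ) (ℱ.le s)
      (f := Set.indicator {ω | (∀ j, ξ s j ω = i j) ∧ coin s ω = false} (fun _ => (1 : ℝ)))
    rw [integral_congr_ae h0, integral_zero, integral_indicator_const _ hset, smul_eq_mul,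
      mul_one] at h1
    exact measure_eq_zero_iff_ae_notMem.1 ((measureReal_eq_zero_iff).1 h1.symm)
  filter_upwards [ae_all_iff.2 hi] with ω hω
  by_contra hc
  exact hω (fun j => ξ s j ω) ⟨fun _ => rfl, by simpa using hc⟩

theorem IsAlgorithmRun.ae_w_eq
    (hrun : IsAlgorithmRun μ ℱ K g f gradf F Q G γ p α x₀ ξ coin x w xbar) (hp : p = 1) :
    ∀ᵐ ω ∂μ, ∀ s, w s ω = x s ω ∧ prev w s ω = prev x s ω := by
  filter_upwards [hrun.ae_coin hp] with ω hω
  have h : ∀ s, w s ω = x s ω := by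
    rintro (_ | s)
    · rw [hrun.w_zero, hrun.x_zero]
    · rw [hrun.w_succ, if_pos (hω s)]
  intro s
  cases s
  exacts [⟨h _, h _⟩, ⟨h _, h _⟩]

theorem IsAlgorithmRun.condExp_mean
    (hrun : IsAlgorithmRun μ ℱ K g f gradf F Q G γ p α x₀ ξ coin x w xbar) (hp : p = 1)
    (hb : 1 ≤ b) (hα : 0 < α) (hg : ProperConvexLSC K g) (hf : IsDistanceGenerating K g f gradf)
    (hdom : effDom K g ⊆ domSubdiff K f) (hcont : ContinuousOn gradf (effDom K g))
    (hx₀ : x₀ ∈ effDom K g) (s : ℕ) (v : E → E → Fin M → ℝ) :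
    μ[fun ω => (b : ℝ)⁻¹ * ∑ j, v (x s ω) (prev w s ω) (ξ s j ω) | ℱ s]
      =ᵐ[μ] fun ω => ∑ k, (Q (x s ω) (prev w s ω) k).toReal * v (x s ω) (prev w s ω) k := by
  have hT : IsSimple (ℱ s) fun ω => (x s ω, prev w s ω) :=
    (hrun.isSimple hα hg hf hdom hcont hx₀ s).comp fun t => (t.1, t.2.2)
  have hlaw : ∀ i : Fin b → Fin M,
      μ[Set.indicator {ω | (fun j => ξ s j ω) = i} (fun _ => (1 : ℝ)) | ℱ s]
        =ᵐ[μ] fun ω => ∏ j, (Q (x s ω) (prev w s ω) (i j)).toReal := by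
    intro i
    refine (condExp_congr_ae (g := Set.indicator {ω | (∀ j, ξ s j ω = i j) ∧ coin s ω = true}
      (fun _ => (1 : ℝ))) ?_).trans ?_
    · filter_upwards [hrun.ae_coin hp] with ω hω
      simp [Set.indicator_apply, hω s, funext_iff]
    · filter_upwards [hrun.sampling s i true] with ω hω
      rw [hω, if_pos rfl, hp, mul_one]
  have h := condExp_of_condLaw (ℱ.le s) hT
    (measurable_pi_lambda (fun ω j => ξ s j ω) (hrun.measurable_index s))
    (q := fun t i => ∏ j, (Q t.1 t.2 (i j)).toReal) hlaw
    fun t i => (b : ℝ)⁻¹ * ∑ j, v t.1 t.2 (i j)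
  filter_upwards [h] with ω hω
  rw [hω]
  exact sum_prod_mul_mean hb (PMF.sum_toReal_eq_one _) _

theorem IsAlgorithmRun.integrable_mean
    (hrun : IsAlgorithmRun μ ℱ K g f gradf F Q G γ p α x₀ ξ coin x w xbar)
    (hα : 0 < α) (hg : ProperConvexLSC K g) (hf : IsDistanceGenerating K g f gradf)
    (hdom : effDom K g ⊆ domSubdiff K f) (hcont : ContinuousOn gradf (effDom K g))
    (hx₀ : x₀ ∈ effDom K g) (s : ℕ) (v : E → E → Fin M → ℝ) :
    Integrable (fun ω => (b : ℝ)⁻¹ * ∑ j, v (x s ω) (prev w s ω) (ξ s j ω)) μ := by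
  have hT : IsSimple mΩ fun ω => (x s ω, prev w s ω) :=
    ((hrun.isSimple hα hg hf hdom hcont hx₀ s).comp fun t => (t.1, t.2.2)).mono (ℱ.le s)
  have hξ : IsSimple mΩ fun ω j => ξ s j ω :=
    .of_measurable (measurable_pi_lambda _ (hrun.measurable_index s))
  exact ((hT.prodMk hξ).comp
    fun t => (b : ℝ)⁻¹ * ∑ j, v t.1.1 t.1.2 (t.2 j)).integrable

theorem IsAlgorithmRun.condExp_lyapunov_le
    (hrun : IsAlgorithmRun μ ℱ K g f gradf F Q G γ p α x₀ ξ coin x w xbar) (hp : p = 1)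
    (hb : 1 ≤ b) (hγ0 : 0 < γ) (hγ1 : γ ≤ 1) (hα : 0 < α)
    (hg : ProperConvexLSC K g) (hf : IsDistanceGenerating K g f gradf)
    (hdom : effDom K g ⊆ domSubdiff K f) (hcont : ContinuousOn gradf (effDom K g))
    (hF : MonotoneOperatorOn (effDom K g) F) {Lbar : ℝ}
    (hQ : IsVariableLipschitzOracle (effDom K g) F Q G Lbar)
    (hx₀ : x₀ ∈ effDom K g) {u : E} (hu : u ∈ solutionSet K g F) (s : ℕ) :
    μ[fun ω => lyapunov f gradf F γ α u (x (s + 1) ω) (prev x (s + 1) ω) | ℱ s]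
      ≤ᵐ[μ] fun ω => lyapunov f gradf F γ α u (x s ω) (prev x s ω)
        - (γ - α * (1 + Lbar ^ 2)) / 2 * ‖x s ω - prev x s ω‖ ^ 2 := by
  have hS := fun n => hrun.isSimple hα hg hf hdom hcont hx₀ n
  have hlyap : ∀ n, Integrable (fun ω => lyapunov f gradf F γ α u (x n ω) (prev x n ω)) μ :=
    fun n => (((hS n).comp fun t => lyapunov f gradf F γ α u t.1 t.2.1).mono (ℱ.le n)).integrable
  have hpre : IsSimple (ℱ s) fun ω => lyapunov f gradf F γ α u (x s ω) (prev x s ω)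
      - (γ - α) / 2 * ‖x s ω - prev x s ω‖ ^ 2 :=
    (hS s).comp fun t => lyapunov f gradf F γ α u t.1 t.2.1 - (γ - α) / 2 * ‖t.1 - t.2.1‖ ^ 2
  have hV := hrun.integrable_mean hα hg hf hdom hcont hx₀ s (oracleDrift F G u)
  have hstep : (fun ω => lyapunov f gradf F γ α u (x (s + 1) ω) (prev x (s + 1) ω))
      ≤ᵐ[μ] (fun ω => lyapunov f gradf F γ α u (x s ω) (prev x s ω)
        - (γ - α) / 2 * ‖x s ω - prev x s ω‖ ^ 2)
        + α • fun ω => (b : ℝ)⁻¹ * ∑ j, oracleDrift F G u (x s ω) (prev w s ω) (ξ s j ω) := by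
    filter_upwards [hrun.ae_w_eq hp] with ω hω
    obtain ⟨h1, h2⟩ := hω s
    have hz := hrun.x_succ s ω
    rw [batchEstimator_eq hb, h1, h2] at hz
    have h3 := lyapunov_step hγ0 hγ1 hα hg hf hdom hcont hF hu
      (hrun.mem_effDom hα hg hx₀ s ω)
      (by rw [prev_apply]; exact prev_induction (fun n => hrun.mem_effDom hα hg hx₀ n ω) s)
      (hrun.xbar_eq s ω) hz
    have h4 := mul_le_mul_of_nonneg_left
      (mean_drift_le hb F G u (x s ω) (prev x s ω) fun j => ξ s j ω) hα.le
    simp only [Pi.add_apply, Pi.smul_apply, smul_eq_mul, h2]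
    exact h3.trans (by simpa using h4)
  have hmono := condExp_mono (m := ℱ s) (hlyap (s + 1))
    ((hpre.mono (ℱ.le s)).integrable.add (hV.smul α)) hstep
  filter_upwards [hmono, condExp_add (hpre.mono (ℱ.le s)).integrable (hV.smul α) (ℱ s),
    condExp_smul α (fun ω => (b : ℝ)⁻¹ * ∑ j, oracleDrift F G u (x s ω) (prev w s ω) (ξ s j ω))
      (ℱ s) (μ := μ),
    hrun.condExp_mean hp hb hα hg hf hdom hcont hx₀ s (oracleDrift F G u),
    hrun.ae_w_eq hp] with ω h1 h2 h3 h4 h5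
  refine h1.trans ?_
  rw [h2, Pi.add_apply, h3, Pi.smul_apply, h4,
    condExp_of_stronglyMeasurable (ℱ.le s) hpre.stronglyMeasurable
      (hpre.mono (ℱ.le s)).integrable, (h5 s).2, smul_eq_mul]
  have h6 := mul_le_mul_of_nonneg_left (hQ.sum_drift_le (u := u)
    (hrun.mem_effDom hα hg hx₀ s ω)
    (by rw [prev_apply]; exact prev_induction (fun n => hrun.mem_effDom hα hg hx₀ n ω) s :
      prev x s ω ∈ effDom K g)) hα.le
  linarith

end Run

/-! ### Almost sure convergence of the run. -/

section Run

variable {E : Type*} [NormedAddCommGroup E] [NormedSpace ℝ E]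
  {Ω : Type*} {mΩ : MeasurableSpace Ω} {μ : Measure Ω} [IsProbabilityMeasure μ]
  {ℱ : Filtration ℕ mΩ} {M b : ℕ}
  {K : Set E} {g f : E → EReal} {gradf : E → StrongDual ℝ E} {F : E → StrongDual ℝ E}
  {Q : E → E → PMF (Fin M)} {G : E → E → Fin M → E → StrongDual ℝ E} {γ p α : ℝ} {x₀ : E}
  {ξ : ℕ → Fin b → Ω → Fin M} {coin : ℕ → Ω → Bool} {x w xbar : ℕ → Ω → E}

/-- The Lyapunov function converges almost surely and the squared increments of the iterates have
summable expectations. -/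
theorem IsAlgorithmRun.lyapunov_convergence
    (hrun : IsAlgorithmRun μ ℱ K g f gradf F Q G γ p α x₀ ξ coin x w xbar) (hp : p = 1)
    (hb : 1 ≤ b) (hγ0 : 0 < γ) (hγ1 : γ ≤ 1) (hα : 0 < α)
    (hg : ProperConvexLSC K g) (hf : IsDistanceGenerating K g f gradf)
    (hdom : effDom K g ⊆ domSubdiff K f) (hcont : ContinuousOn gradf (effDom K g))
    (hF : MonotoneOperatorOn (effDom K g) F) {Lbar : ℝ}
    (hQ : IsVariableLipschitzOracle (effDom K g) F Q G Lbar)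
    (hα1 : 0 < γ - α * (1 + Lbar ^ 2)) {L : ℝ}
    (hα2 : 2 * L ^ 2 * α ^ 2 + α ≤ γ) (hL : LipschitzOperatorOn (effDom K g) F L)
    (hx₀ : x₀ ∈ effDom K g) {u : E} (hu : u ∈ solutionSet K g F) :
    (∀ᵐ ω ∂μ, ∃ l, Tendsto (fun s => lyapunov f gradf F γ α u (x s ω) (prev x s ω)) atTop (𝓝 l))
      ∧ ∃ C, ∀ n, ∑ s ∈ Finset.range n, ∫ ω, ‖x s ω - prev x s ω‖ ^ 2 ∂μ ≤ C := by
  set Φ : ℕ → Ω → ℝ := fun s ω => lyapunov f gradf F γ α u (x s ω) (prev x s ω) with hΦ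
  set δ := (γ - α * (1 + Lbar ^ 2)) / 2 with hδ
  have hδ0 : 0 < δ := half_pos hα1
  have hS := fun n => hrun.isSimple hα hg hf hdom hcont hx₀ n
  have hΦS : ∀ s, IsSimple (ℱ s) (Φ s) := fun s =>
    (hS s).comp fun t => lyapunov f gradf F γ α u t.1 t.2.1
  have hΦi : ∀ s, Integrable (Φ s) μ := fun s => ((hΦS s).mono (ℱ.le s)).integrable
  have heS : ∀ s, Integrable (fun ω => ‖x s ω - prev x s ω‖ ^ 2) μ := fun s =>
    (((hS s).comp fun t => ‖t.1 - t.2.1‖ ^ 2).mono (ℱ.le s)).integrable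
  have hΦ0 : ∀ s ω, 0 ≤ Φ s ω := fun s ω => le_trans (by positivity)
    (sq_le_lyapunov hγ1 hα hα2 hf hdom hL hu.1 (hrun.mem_effDom hα hg hx₀ s ω)
      (by rw [prev_apply]; exact prev_induction (fun n => hrun.mem_effDom hα hg hx₀ n ω) s))
  have hstep := fun s =>
    hrun.condExp_lyapunov_le hp hb hγ0 hγ1 hα hg hf hdom hcont hF hQ hx₀ hu s
  -- The constant comes from telescoping the expected decrease and using `Φ n ≥ 0`.
  refine ⟨?_, (∫ ω, Φ 0 ω ∂μ) / δ, fun n => ?_⟩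
  · refine Supermartingale.ae_exists_tendsto_of_nonneg (ℱ := ℱ) (supermartingale_nat
      (fun s => (hΦS s).stronglyMeasurable) hΦi fun s => ?_) hΦ0
    filter_upwards [hstep s] with ω hω
    exact hω.trans (sub_le_self _ (by positivity))
  · have hint : ∀ s, ∫ ω, Φ (s + 1) ω ∂μ
        ≤ ∫ ω, Φ s ω ∂μ - δ * ∫ ω, ‖x s ω - prev x s ω‖ ^ 2 ∂μ := by
      intro s
      have h := integral_mono_ae integrable_condExp
        ((hΦi s).sub ((heS s).const_mul δ)) (hstep s)
      rw [integral_condExp (ℱ.le s)] at h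
      refine h.trans_eq ?_
      rw [← integral_const_mul]
      exact integral_sub (hΦi s) ((heS s).const_mul δ)
    have hsum : ∀ n, δ * ∑ s ∈ Finset.range n, ∫ ω, ‖x s ω - prev x s ω‖ ^ 2 ∂μ
        ≤ ∫ ω, Φ 0 ω ∂μ - ∫ ω, Φ n ω ∂μ := by
      intro n
      induction n with
      | zero => simp
      | succ n ih =>
        rw [Finset.sum_range_succ, mul_add]
        linarith [hint n]
    rw [le_div_iff₀' hδ0]
    exact (hsum n).trans (sub_le_self _ (integral_nonneg (hΦ0 n)))

/-- The oracle bound transfers summability from the squared steps to the batch mean of the squared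
increments, which dominates the squared norm of their mean. -/
theorem IsAlgorithmRun.ae_tendsto_mean_increment
    (hrun : IsAlgorithmRun μ ℱ K g f gradf F Q G γ p α x₀ ξ coin x w xbar) (hp : p = 1)
    (hb : 1 ≤ b) (hα : 0 < α)
    (hg : ProperConvexLSC K g) (hf : IsDistanceGenerating K g f gradf)
    (hdom : effDom K g ⊆ domSubdiff K f) (hcont : ContinuousOn gradf (effDom K g)) {Lbar : ℝ}
    (hQ : IsVariableLipschitzOracle (effDom K g) F Q G Lbar)
    (hx₀ : x₀ ∈ effDom K g) {C : ℝ}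
    (hC : ∀ n, ∑ s ∈ Finset.range n, ∫ ω, ‖x s ω - prev x s ω‖ ^ 2 ∂μ ≤ C) :
    ∀ᵐ ω ∂μ, Tendsto (fun s => (b : ℝ)⁻¹ • ∑ j,
      oracleIncrement G (x s ω) (prev w s ω) (ξ s j ω)) atTop (𝓝 0) := by
  set v : E → E → Fin M → ℝ := fun a c k => ‖oracleIncrement G a c k‖ ^ 2 with hv
  have hle : ∀ s, ∫ ω, (b : ℝ)⁻¹ * ∑ j, v (x s ω) (prev w s ω) (ξ s j ω) ∂μ
      ≤ Lbar ^ 2 * ∫ ω, ‖x s ω - prev x s ω‖ ^ 2 ∂μ := by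
    intro s
    have hS := (hrun.isSimple hα hg hf hdom hcont hx₀ s).mono (ℱ.le s)
    rw [← integral_condExp (ℱ.le s), ← integral_const_mul]
    refine integral_mono_ae integrable_condExp
      (hS.comp fun t => Lbar ^ 2 * ‖t.1 - t.2.1‖ ^ 2).integrable ?_
    filter_upwards [hrun.condExp_mean hp hb hα hg hf hdom hcont hx₀ s v, hrun.ae_w_eq hp]
      with ω h1 h2
    rw [h1, (h2 s).2]
    exact hQ.lipschitz _ (hrun.mem_effDom hα hg hx₀ s ω) _
      (by rw [prev_apply]; exact prev_induction (fun n => hrun.mem_effDom hα hg hx₀ n ω) s)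
  have h := ae_tendsto_zero_of_sum_integral_le
    (Y := fun s ω => (b : ℝ)⁻¹ * ∑ j, v (x s ω) (prev w s ω) (ξ s j ω)) (C := Lbar ^ 2 * C)
    (fun s ω => by positivity) (fun s => hrun.integrable_mean hα hg hf hdom hcont hx₀ s v)
    fun n => by
      refine (Finset.sum_le_sum fun s _ => hle s).trans ?_
      rw [← Finset.mul_sum]
      exact mul_le_mul_of_nonneg_left (hC n) (sq_nonneg _)
  filter_upwards [h] with ω hω
  have h2 := (squeeze_zero (fun s => sq_nonneg _) (fun s => norm_mean_sq_le
    fun j => oracleIncrement G (x s ω) (prev w s ω) (ξ s j ω)) hω).sqrt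
  simp only [Real.sqrt_sq (norm_nonneg _), Real.sqrt_zero] at h2
  exact tendsto_zero_iff_norm_tendsto_zero.2 h2

/-- Almost sure convergence of a run with `p = 1` to a solution. -/
theorem IsAlgorithmRun.ae_tendsto_solution [FiniteDimensional ℝ E]
    (hrun : IsAlgorithmRun μ ℱ K g f gradf F Q G γ p α x₀ ξ coin x w xbar) (hp : p = 1)
    (hb : 1 ≤ b) (hγ0 : 0 < γ) (hγ1 : γ ≤ 1) (hα : 0 < α) (hK : IsClosed K)
    (hg : ProperConvexLSC K g) (hf : IsDistanceGenerating K g f gradf)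
    (hdom : effDom K g ⊆ domSubdiff K f) (hcont : ContinuousOn gradf (effDom K g))
    (hne : (solutionSet K g F).Nonempty)
    (hF : MonotoneOperatorOn (effDom K g) F) {Lbar : ℝ}
    (hQ : IsVariableLipschitzOracle (effDom K g) F Q G Lbar)
    (hα1 : 0 < γ - α * (1 + Lbar ^ 2)) {L : ℝ}
    (hα2 : 2 * L ^ 2 * α ^ 2 + α ≤ γ) (hL : LipschitzOperatorOn (effDom K g) F L)
    (hx₀ : x₀ ∈ effDom K g) :
    ∀ᵐ ω ∂μ, ∃ zt ∈ solutionSet K g F, Tendsto (fun s => x s ω) atTop (𝓝 zt) := by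
  have hlyap := fun (u : E) (hu : u ∈ solutionSet K g F) =>
    hrun.lyapunov_convergence hp hb hγ0 hγ1 hα hg hf hdom hcont hF hQ hα1 hα2 hL hx₀ hu
  -- In finite dimension an affinely independent set is finite, so the null sets of its points can
  -- be united.
  obtain ⟨t, htS, hspan, hind⟩ := exists_affineIndependent ℝ E (solutionSet K g F)
  have htfin : t.Finite := finite_set_of_fin_dim_affineIndependent ℝ hind
  obtain ⟨u₀, hu₀⟩ := hne
  obtain ⟨C, hC⟩ := (hlyap u₀ hu₀).2
  have hsq := ae_tendsto_zero_of_sum_integral_le (Y := fun s ω => ‖x s ω - prev x s ω‖ ^ 2)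
    (fun s ω => sq_nonneg _) (fun s => (((hrun.isSimple hα hg hf hdom hcont hx₀ s).comp
      fun t => ‖t.1 - t.2.1‖ ^ 2).mono (ℱ.le s)).integrable) hC
  filter_upwards [(ae_ball_iff htfin.countable).2 fun u hu => (hlyap u (htS hu)).1, hsq,
    hrun.ae_tendsto_mean_increment hp hb hα hg hf hdom hcont hQ hx₀ hC, hrun.ae_w_eq hp]
    with ω h1 h2 h3 h4
  have hx := fun s => hrun.mem_effDom hα hg hx₀ s ω
  have hstep : Tendsto (fun s => ‖x s ω - prev (fun n => x n ω) s‖) atTop (𝓝 0) := by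
    have := h2.sqrt
    simp only [Real.sqrt_sq (norm_nonneg _), Real.sqrt_zero] at this
    exact this.congr fun s => by rw [prev_apply]
  refine tendsto_solution hγ0 hγ1 hα hK hg hf hdom hcont hL hx (y := fun s => xbar s ω)
    (fun s => by rw [hrun.xbar_eq, prev_apply]) (fun s => ?_) hstep h3 ⟨u₀, hu₀⟩
    fun u hu => exists_tendsto_bregman_of_mem_affineSpan (t := t) (fun v hv => ?_)
      (hspan ▸ subset_affineSpan ℝ _ hu)
  · have h := hrun.x_succ s ω
    rwa [batchEstimator_eq hb, (h4 s).1] at h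
  · obtain ⟨l, hl⟩ := h1 v hv
    exact exists_tendsto_bregman_of_lyapunov hγ1 hα hα2 hf hdom hL (htS hv).1 hx
      (prev_induction hx) hstep ⟨l, hl.congr fun s => by rw [prev_apply]⟩

end Run

/-- The hypothesis bounds `α` by the positive root of `2 L² α² + α = γ`. -/
theorem step_size_bound {γ α L : ℝ} (hγ : 0 ≤ γ) (hα : 0 < α) (hL : 0 < L)
    (h : α ≤ (Real.sqrt (1 + 8 * γ * L ^ 2) - 1) / (4 * L ^ 2)) :
    2 * L ^ 2 * α ^ 2 + α ≤ γ := by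
  have hL2 : 0 < L ^ 2 := by positivity
  rw [le_div_iff₀ (by positivity)] at h
  have h1 : (α * (4 * L ^ 2) + 1) ^ 2 ≤ 1 + 8 * γ * L ^ 2 :=
    (Real.le_sqrt (by positivity) (by positivity)).1 (by linarith)
  refine le_of_mul_le_mul_right ?_ (show 0 < 8 * L ^ 2 by positivity)
  linarith

end BregmanVI

theorem mainTheorem7
    {E : Type*} [NormedAddCommGroup E] [NormedSpace ℝ E] [FiniteDimensional ℝ E]
    {Ω : Type*} {mΩ : MeasurableSpace Ω} (μ : Measure Ω) [IsProbabilityMeasure μ]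
    (ℱ : Filtration ℕ mΩ)
    {M b : ℕ} (hb : 1 ≤ b) (hbM : b ≤ M)
    -- the data of the variational inequality
    (K : Set E) (hK_closed : IsClosed K) (hK_convex : Convex ℝ K)
    (g : E → EReal) (hg : BregmanVI.ProperConvexLSC K g)
    (Fi : Fin M → E → StrongDual ℝ E)
    -- the distance generating function, with continuous gradient
    (f : E → EReal) (gradf : E → StrongDual ℝ E)
    (hf : BregmanVI.IsDistanceGenerating K g f gradf)
    (hgrad_dom : BregmanVI.effDom K g ⊆ BregmanVI.domSubdiff K f)
    (hgrad_cont : ContinuousOn gradf (BregmanVI.effDom K g))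
    -- (A1): the solution set is nonempty
    (hA1 : (BregmanVI.solutionSet K g (BregmanVI.finiteSum Fi)).Nonempty)
    -- (A2): monotonicity
    (hA2 : BregmanVI.MonotoneOperatorOn (BregmanVI.effDom K g) (BregmanVI.finiteSum Fi))
    -- (A3): variable Lipschitz stochastic oracle, with continuous components
    (Q : E → E → PMF (Fin M)) (G : E → E → Fin M → E → StrongDual ℝ E) (Lbar : ℝ)
    (hA3 : BregmanVI.IsVariableLipschitzOracle (BregmanVI.effDom K g)
      (BregmanVI.finiteSum Fi) Q G Lbar)
    (hG_cont : ∀ u ∈ BregmanVI.effDom K g, ∀ v ∈ BregmanVI.effDom K g, ∀ i,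
      ContinuousOn (G u v i) (BregmanVI.effDom K g))
    -- (A4): Lipschitz continuity
    (L : ℝ) (hL : 0 < L)
    (hA4 : BregmanVI.LipschitzOperatorOn (BregmanVI.effDom K g) (BregmanVI.finiteSum Fi) L)
    -- the parameters
    (γ p α : ℝ) (hγ0 : 0 < γ) (hγ1 : γ ≤ 1) (hp : p = 1) (hα0 : 0 < α)
    (hα1 : α < γ / (1 + Lbar ^ 2))
    (hα2 : α ≤ (Real.sqrt (1 + 8 * γ * L ^ 2) - 1) / (4 * L ^ 2))
    -- a run of the algorithm
    (x₀ : E) (hx₀ : x₀ ∈ BregmanVI.effDom K g)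
    (ξ : ℕ → Fin b → Ω → Fin M) (coin : ℕ → Ω → Bool) (x w xbar : ℕ → Ω → E)
    (hrun : BregmanVI.IsAlgorithmRun μ ℱ K g f gradf (BregmanVI.finiteSum Fi) Q G γ p α x₀
      ξ coin x w xbar) :
    ∃ xt : Ω → E, StronglyMeasurable xt ∧
      ∀ᵐ ω ∂μ, xt ω ∈ BregmanVI.solutionSet K g (BregmanVI.finiteSum Fi) ∧
        Tendsto (fun s => x s ω) atTop (𝓝 (xt ω)) := by
  have hδ : 0 < γ - α * (1 + Lbar ^ 2) := sub_pos.2 ((lt_div_iff₀ (by positivity)).1 hα1)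
  have hae := hrun.ae_tendsto_solution hp hb hγ0 hγ1 hα0 hK_closed hg hf hgrad_dom hgrad_cont hA1
    hA2 hA3 hδ (BregmanVI.step_size_bound hγ0.le hα0 hL hα2) hA4 hx₀
  -- The solution chosen for each `ω` need not be measurable; a measurable almost sure limit of the
  -- iterates agrees with it almost surely.
  obtain ⟨xt, hxt, hlim⟩ := exists_stronglyMeasurable_limit_of_tendsto_ae
    (fun s => ((hrun.adapted_x s).mono (ℱ.le s)).aestronglyMeasurable)
    (hae.mono fun ω ⟨z, _, hz⟩ => ⟨z, hz⟩)
  refine ⟨xt, hxt, ?_⟩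
  filter_upwards [hae, hlim] with ω ⟨z, hzS, hz⟩ hω
  exact ⟨tendsto_nhds_unique hz hω ▸ hzS, hω⟩
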